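/- Let $M$ be an oriented matroid on a finite linearly ordered set $E$. For $A\subseteq E$ let $-_AM$ denote the oriented matroid obtained from $M$ by reversing the signs of the elements of $A$ in all signed circuits. For an oriented matroid $N$ on $E$ let $$O(N)=\{\min(C) : C \text{ a positive circuit of } N\},\qquad O^*(N)=\{\min(D) : D \text{ a positive cocircuit of } N\},$$ where a signed circuit or cocircuit is positive if all its elements have positive sign, and $\min$ is taken over its support. For $A\subseteq E$ put $$\Theta_M(A)=O(-_AM)\setminus A,\quad \bar\Theta_M(A)=O(-_AM)\cap A,\quad \Theta^*_M(A)=O^*(-_AM)\setminus A,\quad \bar\Theta^*_M(A)=O^*(-_AM)\cap A.$$ Let $t(M;X,Y)=\sum_{A\subseteq E}(X-1)^{r(E)-r(A)}(Y-1)^{|A|-r(A)}$ be the Tutte polynomial of the underlying matroid of $M$, where $r$ is its rank function. Then $$t(M;x+u,y+v)=\sum_{A\subseteq E} x^{|\Theta^*_M(A)|}\,u^{|\bar\Theta^*_M(A)|}\,y^{|\Theta_M(A)|}\,v^{|\bar\Theta_M(A)|}$$ as an identity of polynomials in $x,u,y,v$ with integer coefficients; equivalently, for all elements $x,u,y,v$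 of any commutative ring. -/

import Mathlib

/-- The signed set obtained from `X` by reversing the signs of the elements of `A`. -/
def SignedSet.flip {α : Type*} [DecidableEq α] (A : Finset α) (X : α → SignType) : α → SignType :=
  fun e => if e ∈ A then -X e else X e

/-- Two signed sets are orthogonal if some `e` has the same nonzero sign in both and some `f` has
opposite nonzero signs in both, or if neither such `e` nor such `f` exists (which means that the
supports are disjoint). -/
def SignedSet.Orthogonal {α : Type*} (X Y : α → SignType) : Prop :=
  (∃ e, X e * Y e = 1) ↔ (∃ f, X f * Y f = -1)

/-- An oriented matroid on the finite ground set `E`, given by its signed circuits. A signed set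
`(X⁺, X⁻)` is encoded as the function `X : α → SignType` with `X⁺ = {e | X e = 1}` and
`X⁻ = {e | X e = -1}`; its support is `Function.support X`. -/
structure OrientedMatroid (α : Type*) where
  E : Finset α
  IsCircuit : (α → SignType) → Prop
  support_subset : ∀ X, IsCircuit X → Function.support X ⊆ (E : Set α)
  not_isCircuit_zero : ¬ IsCircuit 0
  isCircuit_neg : ∀ X, IsCircuit X → IsCircuit (-X)
  incomparable : ∀ X Y, IsCircuit X → IsCircuit Y →
    Function.support X ⊆ Function.support Y → X = Y ∨ X = -Y
  elimination : ∀ X Y e, IsCircuit X → IsCircuit Y → X ≠ -Y → X e = 1 → Y e = -1 →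
    ∃ Z, IsCircuit Z ∧ Z e = 0 ∧
      (∀ f, Z f = 1 → X f = 1 ∨ Y f = 1) ∧ (∀ f, Z f = -1 → X f = -1 ∨ Y f = -1)

namespace OrientedMatroid

/-- A set is independent if it is a subset of the ground set that contains the support of no
signed circuit. -/
def Indep {α : Type*} (M : OrientedMatroid α) (I : Set α) : Prop :=
  I ⊆ (M.E : Set α) ∧ ∀ X, M.IsCircuit X → ¬ Function.support X ⊆ I

theorem support_neg_eq {α : Type*} (X : α → SignType) :
    Function.support (-X) = Function.support X := by
  have key : ∀ s : SignType, -s ≠ 0 ↔ s ≠ 0 := by decide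
  ext e
  exact key (X e)

/-- Elimination for the supports of signed circuits. -/
theorem support_elimination {α : Type*} (M : OrientedMatroid α) {X Y : α → SignType} {e : α}
    (hX : M.IsCircuit X) (hY : M.IsCircuit Y) (hXY : Function.support X ≠ Function.support Y)
    (heX : X e ≠ 0) (heY : Y e ≠ 0) :
    ∃ Z, M.IsCircuit Z ∧
      Function.support Z ⊆ (Function.support X ∪ Function.support Y) \ {e} := by
  have main : ∀ X Y : α → SignType, M.IsCircuit X → M.IsCircuit Y →
      Function.support X ≠ Function.support Y → X e = 1 → Y e = -1 → ∃ Z, M.IsCircuit Z ∧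
      Function.support Z ⊆ (Function.support X ∪ Function.support Y) \ {e} := by
    intro X Y hX hY hXY h1 h2
    obtain ⟨Z, hZ, hZe, hp, hn⟩ := M.elimination X Y e hX hY
      (fun h => hXY (by rw [h, support_neg_eq])) h1 h2
    refine ⟨Z, hZ, fun f hf => ⟨?_, ?_⟩⟩
    · have hf' : Z f ≠ 0 := hf
      have h3 : Z f = 1 ∨ Z f = -1 := by
        revert hf'; generalize Z f = s; revert s; decide
      simp only [Set.mem_union, Function.mem_support]
      rcases h3 with h | h
      · rcases hp f h with h' | h'
        · left; rw [h']; decide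
        · right; rw [h']; decide
      · rcases hn f h with h' | h'
        · left; rw [h']; decide
        · right; rw [h']; decide
    · rintro rfl
      exact hf hZe
  have tri : ∀ s : SignType, s ≠ 0 → s = 1 ∨ s = -1 := by decide
  have hY' := M.isCircuit_neg Y hY
  have neg1 : ∀ s : SignType, s = 1 → -s = -1 := by decide
  have neg2 : ∀ s : SignType, s = -1 → -s = 1 := by decide
  rcases tri _ heX with h1 | h1 <;> rcases tri _ heY with h2 | h2
  · have := main X (-Y) hX hY' (by rwa [support_neg_eq]) h1 (neg1 _ h2)
    rwa [support_neg_eq] at this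
  · exact main X Y hX hY hXY h1 h2
  · have := main Y X hY hX hXY.symm h2 h1
    rwa [Set.union_comm] at this
  · have := main (-Y) X hY' hX (by rw [support_neg_eq]; exact hXY.symm) (neg2 _ h2) h1
    rwa [support_neg_eq, Set.union_comm] at this

theorem indep_aug {α : Type*} (M : OrientedMatroid α) ⦃I J : Set α⦄ (hI : M.Indep I)
    (hJ : M.Indep J) (hIJ : I.ncard < J.ncard) : ∃ e ∈ J, e ∉ I ∧ M.Indep (insert e I) := by
  classical
  by_contra! hcon
  have hfin : ∀ {K : Set α}, M.Indep K → K.Finite := fun hK => M.E.finite_toSet.subset hK.1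
  have hex : ∃ n, ∃ K, M.Indep K ∧ K ⊆ I ∪ J ∧ I.ncard < K.ncard ∧ (I \ K).ncard = n :=
    ⟨_, J, hJ, Set.subset_union_right, hIJ, rfl⟩
  obtain ⟨K, hK, hKIJ, hcard, hn⟩ := Nat.find_spec hex
  have hmin : ∀ T, M.Indep T → T ⊆ I ∪ J → I.ncard < T.ncard →
      (I \ K).ncard ≤ (I \ T).ncard := fun T h1 h2 h3 =>
    hn ▸ Nat.find_min' hex ⟨T, h1, h2, h3, rfl⟩
  have hKI : ∃ f ∈ K, f ∉ I := by
    by_contra! h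
    exact absurd (Set.ncard_le_ncard h (hfin hI)) (by omega)
  have hIK : ∃ e ∈ I, e ∉ K := by
    by_contra! h
    obtain ⟨f, hfK, hfI⟩ := hKI
    refine hcon f ((hKIJ hfK).resolve_left hfI) hfI ⟨?_, fun X hX hXs => ?_⟩
    · exact fun a ha => hK.1 (ha.elim (fun h' => h' ▸ hfK) (h a))
    · exact hK.2 X hX (hXs.trans fun a ha => ha.elim (fun h' => h' ▸ hfK) (h a))
  obtain ⟨e, heI, heK⟩ := hIK
  have hC : ∀ f ∈ K, f ∉ I → ∃ X, M.IsCircuit X ∧ X e ≠ 0 ∧ X f = 0 ∧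
      Function.support X ⊆ insert e K := by
    intro f hfK hfI
    have hef : e ≠ f := fun h => hfI (h ▸ heI)
    have hnot : ¬ M.Indep ((insert e K) \ {f}) := by
      intro hT
      have h1 := hmin _ hT
        (fun a ha => ha.1.elim (fun h => h ▸ Or.inl heI) (fun h => hKIJ h))
        (by
          rw [Set.ncard_sdiff_singleton_of_mem (Set.mem_insert_of_mem e hfK),
            Set.ncard_insert_of_notMem heK (hfin hK)]
          omega)
      refine absurd h1 (not_le.2 (Set.ncard_lt_ncard ⟨?_, ?_⟩ ((hfin hI).subset Set.sdiff_subset)))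
      · intro a ha
        exact ⟨ha.1, fun h => ha.2 ⟨Set.mem_insert_of_mem _ h, fun h' => hfI (h' ▸ ha.1)⟩⟩
      · intro h
        exact (h ⟨heI, heK⟩).2 ⟨Set.mem_insert _ _, hef⟩
    have hE : (insert e K) \ {f} ⊆ (M.E : Set α) := fun a ha =>
      ha.1.elim (fun h => h ▸ hI.1 heI) (fun h => hK.1 h)
    have : ∃ X, M.IsCircuit X ∧ Function.support X ⊆ (insert e K) \ {f} := by
      by_contra! h
      exact hnot ⟨hE, h⟩
    obtain ⟨X, hX, hXs⟩ := this
    refine ⟨X, hX, fun h => ?_, ?_, hXs.trans Set.sdiff_subset⟩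
    · exact hK.2 X hX fun a ha => (hXs ha).1.resolve_left fun h' => ha (h' ▸ h)
    · by_contra h
      exact (hXs h).2 rfl
  obtain ⟨f, hfK, hfI⟩ := hKI
  obtain ⟨X, hX, hXe, hXf, hXs⟩ := hC f hfK hfI
  have hg : ∃ g ∈ K, g ∉ I ∧ X g ≠ 0 := by
    by_contra! h
    refine hI.2 X hX fun a ha => ?_
    by_contra haI
    rcases hXs ha with h' | h'
    · exact haI (h' ▸ heI)
    · exact ha (h a h' haI)
  obtain ⟨g, hgK, hgI, hXg⟩ := hg
  obtain ⟨Y, hY, hYe, hYg, hYs⟩ := hC g hgK hgI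
  have hne : Function.support X ≠ Function.support Y := fun h => by
    have h1 : g ∈ Function.support Y := h ▸ hXg
    exact h1 hYg
  obtain ⟨Z, hZ, hZs⟩ := M.support_elimination hX hY hne hXe hYe
  exact hK.2 Z hZ fun a ha =>
    ((hZs ha).1.elim (fun h => hXs h) (fun h => hYs h)).resolve_left (hZs ha).2

/-- The underlying matroid: its circuits are the supports of the signed circuits. -/
def underlying {α : Type*} (M : OrientedMatroid α) : Matroid α :=
  (IndepMatroid.ofFinite M.E.finite_toSet M.Indep
    ⟨Set.empty_subset _, fun _ hX h => M.not_isCircuit_zero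
      ((Function.support_eq_empty_iff.1 (Set.subset_empty_iff.1 h)) ▸ hX)⟩
    (fun _ _ hJ hIJ => ⟨hIJ.trans hJ.1, fun X hX h => hJ.2 X hX (h.trans hIJ)⟩)
    M.indep_aug (fun _ hI => hI.1)).matroid

/-- The reorientation `-_A M`. -/
def reorient {α : Type*} [DecidableEq α] (M : OrientedMatroid α) (A : Finset α) :
    OrientedMatroid α where
  E := M.E
  IsCircuit X := M.IsCircuit (SignedSet.flip A X)
  support_subset X hX e he := M.support_subset _ hX (by
    simp only [Function.mem_support, SignedSet.flip] at he ⊢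
    revert he; generalize X e = s; split_ifs <;> revert s <;> decide)
  not_isCircuit_zero h := M.not_isCircuit_zero (by
    have : SignedSet.flip A (0 : α → SignType) = 0 := by
      funext e; simp only [SignedSet.flip, Pi.zero_apply]; split_ifs <;> rfl
    rwa [this] at h)
  isCircuit_neg X hX := by
    have : SignedSet.flip A (-X) = -SignedSet.flip A X := by
      funext e; simp only [SignedSet.flip, Pi.neg_apply]; split_ifs <;> rfl
    rw [this]; exact M.isCircuit_neg _ hX
  incomparable X Y hX hY hXY := by
    have hs : ∀ X : α → SignType,
        Function.support (SignedSet.flip A X) = Function.support X := by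
      intro X; ext e
      simp only [Function.mem_support, SignedSet.flip]
      generalize X e = s; split_ifs <;> revert s <;> decide
    have hflip : ∀ s t : SignType, -s = -t → s = t := by decide
    rcases M.incomparable _ _ hX hY (by rwa [hs, hs]) with h | h
    · left; funext e
      have := congrFun h e
      simp only [SignedSet.flip] at this
      split_ifs at this
      · exact hflip _ _ this
      · exact this
    · right; funext e
      have := congrFun h e
      simp only [SignedSet.flip, Pi.neg_apply] at this ⊢
      split_ifs at this
      · exact hflip _ _ this
      · exact this
  elimination X Y e hX hY hne h1 h2 := by
    have hinv : ∀ X : α → SignType, SignedSet.flip A (SignedSet.flip A X) = X := by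
      intro X; funext e
      simp only [SignedSet.flip]
      generalize X e = s; split_ifs <;> revert s <;> decide
    have hneg : ∀ X : α → SignType, SignedSet.flip A (-X) = -SignedSet.flip A X := by
      intro X; funext e; simp only [SignedSet.flip, Pi.neg_apply]; split_ifs <;> rfl
    have key : ∀ X Y : α → SignType, M.IsCircuit X → M.IsCircuit Y → X ≠ -Y →
        X e = 1 → Y e = -1 → ∃ Z, M.IsCircuit (SignedSet.flip A Z) ∧ Z e = 0 ∧
        (∀ f, Z f = 1 → SignedSet.flip A X f = 1 ∨ SignedSet.flip A Y f = 1) ∧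
        (∀ f, Z f = -1 → SignedSet.flip A X f = -1 ∨ SignedSet.flip A Y f = -1) := by
      intro X Y hX hY hne h1 h2
      obtain ⟨Z, hZ, hZe, hp, hn⟩ := M.elimination X Y e hX hY hne h1 h2
      refine ⟨SignedSet.flip A Z, by rwa [hinv], ?_, fun f => ?_, fun f => ?_⟩
      · simp only [SignedSet.flip, hZe]; split_ifs <;> rfl
      all_goals
        have h3 := hp f
        have h4 := hn f
        simp only [SignedSet.flip]
        revert h3 h4
        generalize X f = s
        generalize Y f = t
        generalize Z f = r
        split_ifs <;> revert s t r <;> decide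
    have hne' : SignedSet.flip A X ≠ -SignedSet.flip A Y := fun h => hne (by
      rw [← hneg] at h
      rw [← hinv X, h, hinv])
    by_cases heA : e ∈ A
    · have := key (SignedSet.flip A Y) (SignedSet.flip A X) hY hX
        (fun h => hne' (by rw [h, neg_neg])) (by simp [SignedSet.flip, heA, h2])
        (by simp [SignedSet.flip, heA, h1])
      simp only [hinv] at this
      obtain ⟨Z, hZ, hZe, hp, hn⟩ := this
      exact ⟨Z, hZ, hZe, fun f hf => (hp f hf).symm, fun f hf => (hn f hf).symm⟩
    · have := key (SignedSet.flip A X) (SignedSet.flip A Y) hX hY hne'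
        (by simp [SignedSet.flip, heA, h1]) (by simp [SignedSet.flip, heA, h2])
      simpa only [hinv] using this

/-- Signed cocircuits (the signed circuits of the dual oriented matroid): the signed sets that are
supported on a cocircuit of the underlying matroid and are orthogonal to all signed circuits. -/
def IsCocircuit {α : Type*} (M : OrientedMatroid α) (Y : α → SignType) : Prop :=
  M.underlying.IsCocircuit (Function.support Y) ∧
    ∀ X, M.IsCircuit X → SignedSet.Orthogonal X Y

/-- The set `O(M)` of active elements: the least elements of the positive circuits. -/
noncomputable def active {α : Type*} [LinearOrder α] (M : OrientedMatroid α) : Finset α :=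
  open scoped Classical in
  M.E.filter fun a => ∃ X, M.IsCircuit X ∧ (∀ e, 0 ≤ X e) ∧ IsLeast (Function.support X) a

/-- The set `O*(M)` of dual-active elements: the least elements of the positive cocircuits. -/
noncomputable def dualActive {α : Type*} [LinearOrder α] (M : OrientedMatroid α) : Finset α :=
  open scoped Classical in
  M.E.filter fun a => ∃ Y, M.IsCocircuit Y ∧ (∀ e, 0 ≤ Y e) ∧ IsLeast (Function.support Y) a

/-- `Θ_M(A) = O(-_A M) \ A`. -/
noncomputable def theta {α : Type*} [LinearOrder α] (M : OrientedMatroid α) (A : Finset α) :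
    Finset α :=
  (M.reorient A).active \ A

/-- `Θ̄_M(A) = O(-_A M) ∩ A`. -/
noncomputable def thetaBar {α : Type*} [LinearOrder α] (M : OrientedMatroid α) (A : Finset α) :
    Finset α :=
  (M.reorient A).active ∩ A

/-- `Θ*_M(A) = O*(-_A M) \ A`. -/
noncomputable def thetaStar {α : Type*} [LinearOrder α] (M : OrientedMatroid α) (A : Finset α) :
    Finset α :=
  (M.reorient A).dualActive \ A

/-- `Θ̄*_M(A) = O*(-_A M) ∩ A`. -/
noncomputable def thetaStarBar {α : Type*} [LinearOrder α] (M : OrientedMatroid α)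
    (A : Finset α) : Finset α :=
  (M.reorient A).dualActive ∩ A

/-- The rank of a set in the underlying matroid. -/
noncomputable def rank {α : Type*} (M : OrientedMatroid α) (A : Finset α) : ℕ :=
  (M.underlying.eRk (A : Set α)).toNat

/-- The Tutte polynomial of the underlying matroid,
`t(M; X₀, X₁) = ∑_{A ⊆ E} (X₀ - 1) ^ (r(E) - r(A)) (X₁ - 1) ^ (|A| - r(A))`. -/
noncomputable def tuttePolynomial {α : Type*} (M : OrientedMatroid α) :
    MvPolynomial (Fin 2) ℤ :=
  ∑ A ∈ M.E.powerset, (MvPolynomial.X 0 - 1) ^ (M.rank M.E - M.rank A) *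
    (MvPolynomial.X 1 - 1) ^ (A.card - M.rank A)

end OrientedMatroid

/-! Both sides obey the same deletion-contraction recursion at the greatest element `ω` of a minor
on `insert ω T`. For the rank generating sum this is classical. For the activity sum, pair the
reorientations `A` and `insert ω A` with `A ⊆ T`. Since `ω` is greatest, it is active only if it is
a loop or a coloop; it is then active in both members of the pair, which gives the factor `y + v` or
`x + u`. Otherwise one member of the pair has the activities of the deletion of `ω` and the other
those of the contraction (`isActive_dichotomy`).

The dichotomy comes from three facts. For circuits, the elements of `T` active in at least one
member of the pair are those active in the contraction. Those active in both are those active in the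
deletion, and the two active sets are nested (`IsActive.min_delete`). The same holds for cocircuits
with deletion and contraction exchanged. Finally, circuits and cocircuits cannot both have the
strictly larger active set in the same member (`not_isActive_isActive`).

Minors are not constructed: circuits that vanish on the deleted set `Z` and cocircuits that vanish
on the contracted set `W` are traced on `S`. The signs enter only through `IsDualPair`, that is
orthogonality and a painting property of Minty type, which is self-dual. Painting in turn needs
every cocircuit of the underlying matroid to carry a signature orthogonal to all signed circuits
(`exists_isCocircuit_support_eq`). -/

/-! ### Cocircuits and closure in matroids. -/

theorem Matroid.exists_isCocircuit_of_notMem_closure {α : Type*} {N : Matroid α} {a : α}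
    {W : Set α} (ha : a ∈ N.E) (hW : W ⊆ N.E) (haW : a ∉ N.closure W) :
    ∃ K, N.IsCocircuit K ∧ a ∈ K ∧ Disjoint K W := by
  obtain ⟨I, hI⟩ := N.exists_isBasis W
  have haI : a ∉ N.closure I := by rwa [hI.closure_eq_closure]
  have hind : N.Indep (insert a I) := by
    rw [hI.indep.insert_indep_iff]
    exact Or.inl ⟨ha, haI⟩
  obtain ⟨B, hB, hIB⟩ := hind.exists_isBase_superset
  have haB : a ∈ B := hIB (Set.mem_insert _ _)
  refine ⟨N.fundCocircuit a B, N.fundCocircuit_isCocircuit haB hB, N.mem_fundCocircuit a B, ?_⟩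
  have hinter := N.fundCocircuit_inter_eq haB
  have haW' : a ∉ W := fun h => haW (N.mem_closure_of_mem h)
  rw [Set.disjoint_left]
  intro w hwK hwW
  have hwI : w ∉ I := fun h => by
    have : w ∈ ({a} : Set α) := hinter ▸ ⟨hwK, hIB (Set.mem_insert_of_mem _ h)⟩
    exact haW' (this ▸ hwW)
  -- The fundamental cocircuit meets `insert a I` only in `a`, so a circuit through `w` inside
  -- `insert w I` would meet it in `w` alone.
  obtain ⟨C, hCI, hC, hwC⟩ := Matroid.exists_isCircuit_of_mem_closure (hI.subset_closure hwW) hwI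
  refine hC.inter_isCocircuit_ne_singleton (N.fundCocircuit_isCocircuit haB hB) (e := w) ?_
  refine Set.Subset.antisymm ?_ (by simpa using ⟨hwC, hwK⟩)
  rintro z ⟨hzC, hzK⟩
  rcases hCI hzC with h | h
  · exact h
  · exfalso
    have : z ∈ ({a} : Set α) := hinter ▸ ⟨hzK, hIB (Set.mem_insert_of_mem _ h)⟩
    exact haW' (this ▸ hI.subset h)

/-- Otherwise a cocircuit through `f` avoiding `e` and `N.E \ K` would lie properly inside `K`. -/
theorem Matroid.IsCocircuit.mem_closure_insert {α : Type*} {N : Matroid α} {K : Set α}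
    (hK : N.IsCocircuit K) {e f : α} (he : e ∈ K) (hf : f ∈ K) {B : Set α}
    (hB : N.IsBasis B (N.E \ K)) : f ∈ N.closure (insert e B) := by
  by_contra hcl
  have hBE : insert e B ⊆ N.E := Set.insert_subset (hK.subset_ground he) hB.indep.subset_ground
  obtain ⟨K', hK', hfK', hdis⟩ := Matroid.exists_isCocircuit_of_notMem_closure
    (W := insert e (N.E \ K)) (hK.subset_ground hf)
    (Set.insert_subset (hK.subset_ground he) Set.sdiff_subset)
    (by rwa [← N.closure_insert_congr_right hB.closure_eq_closure])
  have hsub : K' ⊆ K := fun z hz => by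
    by_contra hzK
    exact Set.disjoint_left.1 hdis hz (Set.mem_insert_of_mem _ ⟨hK'.subset_ground hz, hzK⟩)
  have heq := hK'.isCircuit.eq_of_subset_isCircuit hK.isCircuit hsub
  exact Set.disjoint_left.1 hdis (heq ▸ he) (Set.mem_insert _ _)

namespace OrientedMatroid

/-! ### Existence of signed cocircuits. -/

section Painting

variable {α : Type*} (M : OrientedMatroid α)

instance : M.underlying.Finite := ⟨M.E.finite_toSet⟩

theorem IsCircuit.isCircuit_support {X : α → SignType} (hX : M.IsCircuit X) :
    M.underlying.IsCircuit (Function.support X) := by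
  rw [Matroid.isCircuit_iff_forall_ssubset]
  refine ⟨⟨fun h => h.2 X hX subset_rfl, M.support_subset X hX⟩, fun I hI => ?_⟩
  refine ⟨hI.subset.trans (M.support_subset X hX), fun Y hY hYI => ?_⟩
  have hYX := hYI.trans hI.subset
  rcases M.incomparable Y X hY hX hYX with rfl | rfl
  · exact hI.not_subset hYI
  · rw [support_neg_eq] at hYI
    exact hI.not_subset hYI

theorem exists_isCircuit_of_underlying {C : Set α} (hC : M.underlying.IsCircuit C) :
    ∃ X, M.IsCircuit X ∧ Function.support X = C := by
  have hnot := hC.not_indep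
  have : ∃ X, M.IsCircuit X ∧ Function.support X ⊆ C := by
    by_contra! h
    exact hnot ⟨hC.subset_ground, h⟩
  obtain ⟨X, hX, hXC⟩ := this
  exact ⟨X, hX, (IsCircuit.isCircuit_support M hX).eq_of_subset_isCircuit hC hXC⟩

/-- Elimination of an element at which the signs are opposite. -/
theorem elimination_of_neg {X Y : α → SignType} {e : α} (hX : M.IsCircuit X)
    (hY : M.IsCircuit Y) (hne : X ≠ -Y) (h0 : X e ≠ 0) (he : X e = -Y e) :
    ∃ Z, M.IsCircuit Z ∧ Z e = 0 ∧ ∀ f, Z f = 0 ∨ Z f = X f ∨ Z f = Y f := by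
  have fin : ∀ r s t : SignType, (r = 1 → s = 1 ∨ t = 1) → (r = -1 → s = -1 ∨ t = -1) →
      r = 0 ∨ r = s ∨ r = t := by decide
  have tri : ∀ s t : SignType, s ≠ 0 → s = -t → (s = 1 ∧ t = -1) ∨ (t = 1 ∧ s = -1) := by decide
  rcases tri _ _ h0 he with ⟨h1, h2⟩ | ⟨h1, h2⟩
  · obtain ⟨Z, hZ, hZe, hp, hn⟩ := M.elimination X Y e hX hY hne h1 h2
    exact ⟨Z, hZ, hZe, fun f => fin _ _ _ (hp f) (hn f)⟩
  · obtain ⟨Z, hZ, hZe, hp, hn⟩ := M.elimination Y X e hY hX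
      (fun h => hne (by rw [h, neg_neg])) h1 h2
    exact ⟨Z, hZ, hZe, fun f => by have := fin _ _ _ (hp f) (hn f); tauto⟩

/-- A circuit in the closure relation, with a prescribed sign. -/
theorem exists_isCircuit_of_mem_closure {I : Set α} {a : α} (ha : a ∈ M.underlying.closure I)
    (haI : a ∉ I) {s : SignType} (hs : s ≠ 0) :
    ∃ X, M.IsCircuit X ∧ X a = s ∧ ∀ e, X e ≠ 0 → e = a ∨ e ∈ I := by
  obtain ⟨C, hCI, hC, haC⟩ := Matroid.exists_isCircuit_of_mem_closure ha haI
  obtain ⟨X, hX, rfl⟩ := M.exists_isCircuit_of_underlying hC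
  have tri : ∀ s t : SignType, s ≠ 0 → t ≠ 0 → s = t ∨ -s = t := by decide
  rcases tri _ _ haC hs with h | h
  · exact ⟨X, hX, h, fun e he => hCI he⟩
  · refine ⟨-X, M.isCircuit_neg X hX, h, fun e he => hCI ?_⟩
    rwa [← support_neg_eq]

/-- No circuit whose support lies in `B ∪ K` meets `K` with only nonnegative products. -/
def SignsAgainst (K B : Set α) (Y : α → SignType) : Prop :=
  ∀ X, M.IsCircuit X → (∀ e, X e ≠ 0 → e ∈ B ∪ K) → (∀ e ∈ K, 0 ≤ X e * Y e) →
    ∀ e ∈ K, X e = 0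

theorem exists_mem_of_subset_union {K B : Set α} (hB : M.underlying.Indep B)
    {X : α → SignType} (hX : M.IsCircuit X) (h : ∀ e, X e ≠ 0 → e ∈ B ∪ K) :
    ∃ e ∈ K, X e ≠ 0 := by
  by_contra! hc
  refine hB.2 X hX fun e he => (h e he).resolve_right fun heK => he (hc e heK)

theorem exists_ne_mem_of_isCocircuit {K : Set α} (hK : M.underlying.IsCocircuit K)
    {X : α → SignType} (hX : M.IsCircuit X) {e : α} (he : e ∈ K) (hXe : X e ≠ 0) :
    ∃ f ∈ K, f ≠ e ∧ X f ≠ 0 := by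
  by_contra! hc
  refine (IsCircuit.isCircuit_support M hX).inter_isCocircuit_ne_singleton hK (e := e) ?_
  refine Set.Subset.antisymm ?_ (by simpa using ⟨hXe, he⟩)
  rintro z ⟨hz, hzK⟩
  by_contra hze
  exact hz (hc z hzK hze)

/-- Each `f ∈ K` other than a fixed `e₀` lies on a circuit `F f` that meets `K` exactly in `e₀` and
`f`. Orthogonality to these circuits dictates `Y` once `Y e₀ = 1`. Any offending circuit is reduced
by elimination against some `F f`. -/
theorem exists_signsAgainst {K : Set α} (hK : M.underlying.IsCocircuit K) {B : Set α}
    (hB : M.underlying.IsBasis B (M.underlying.E \ K)) :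
    ∃ Y : α → SignType, Function.support Y = K ∧ M.SignsAgainst K B Y := by
  classical
  obtain ⟨e₀, he₀⟩ := hK.nonempty
  have hBK : ∀ e ∈ B, e ∉ K := fun e he => (hB.subset he).2
  have hcirc : ∀ f, f ∈ K → f ≠ e₀ → ∃ X, M.IsCircuit X ∧ X e₀ = 1 ∧ X f ≠ 0 ∧
      (∀ e, X e ≠ 0 → e ∈ B ∨ e = e₀ ∨ e = f) := by
    intro f hf hfe
    obtain ⟨X, hX, hXf, hXB⟩ := M.exists_isCircuit_of_mem_closure (a := f) (s := 1)
      (hK.mem_closure_insert he₀ hf hB)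
      (by rintro (h | h); exacts [hfe h, hBK f h hf]) (by decide)
    have hX0 : X e₀ ≠ 0 := by
      obtain ⟨g, hgK, hgf, hXg⟩ := M.exists_ne_mem_of_isCocircuit hK hX hf (by rw [hXf]; decide)
      rcases hXB g hXg with h | h | h
      · exact absurd h hgf
      · rwa [← h]
      · exact absurd hgK (hBK g h)
    have hsupp : ∀ e, X e ≠ 0 → e ∈ B ∨ e = e₀ ∨ e = f := fun e he => by
      rcases hXB e he with h | h | h
      exacts [Or.inr (Or.inr h), Or.inr (Or.inl h), Or.inl h]
    have tri : ∀ s : SignType, s ≠ 0 → s = 1 ∨ -s = 1 := by decide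
    rcases tri _ hX0 with h | h
    · exact ⟨X, hX, h, by rw [hXf]; decide, hsupp⟩
    · exact ⟨-X, M.isCircuit_neg X hX, h, by simp [hXf],
        fun e he => hsupp e (fun h0 => he (by simp [h0]))⟩
  choose! F hF hF0 hFf hFs using hcirc
  set Y : α → SignType := fun f => if f = e₀ then 1 else if f ∈ K then -F f f else 0 with hY
  have hY0 : Y e₀ = 1 := by simp [hY]
  have hYf : ∀ f ∈ K, f ≠ e₀ → Y f = -F f f := fun f hf hfe => by simp [hY, hf, hfe]
  refine ⟨Y, ?_, ?_⟩
  · ext f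
    rw [Function.mem_support]
    by_cases hf0 : f = e₀
    · simp [hf0, hY0, he₀]
    · by_cases hf : f ∈ K
      · simp [hYf f hf hf0, hf, hFf f hf hf0]
      · simp [hY, hf0, hf]
  · -- induction on the number of elements of the support in `K \ {e₀}`
    suffices h : ∀ n (X : α → SignType), M.IsCircuit X → (∀ e, X e ≠ 0 → e ∈ B ∪ K) →
        (∀ e ∈ K, 0 ≤ X e * Y e) → ((Function.support X ∩ K) \ {e₀}).ncard = n → False by
      intro X hX hXB hpos
      exact (h _ X hX hXB hpos rfl).elim
    intro n
    induction n using Nat.strong_induction_on with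
    | _ n ih =>
      intro X hX hXB hpos hn
      -- A circuit never meets a cocircuit in a single element, so there is something besides `e₀`
      -- to eliminate.
      have hex : ∃ f ∈ K, f ≠ e₀ ∧ X f ≠ 0 := by
        obtain ⟨f, hf, hXf⟩ := M.exists_mem_of_subset_union hB.indep hX hXB
        by_cases hfe : f = e₀
        · subst hfe
          exact M.exists_ne_mem_of_isCocircuit hK hX hf hXf
        · exact ⟨f, hf, hfe, hXf⟩
      obtain ⟨f, hf, hfe, hXf⟩ := hex
      have sgn : ∀ s t : SignType, s ≠ 0 → 0 ≤ s * -t → t ≠ 0 → s = -t := by decide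
      have hopp : X f = -F f f :=
        sgn _ _ hXf (by simpa [hYf f hf hfe] using hpos f hf) (hFf f hf hfe)
      have hne : X ≠ -F f := by
        intro h
        have h1 := hpos e₀ he₀
        rw [h, Pi.neg_apply, hF0 f hf hfe, hY0] at h1
        revert h1; decide
      obtain ⟨Z, hZ, hZf, hZs⟩ := M.elimination_of_neg hX (hF f hf hfe) hne hXf hopp
      have hFK : ∀ e ∈ K, e ≠ e₀ → e ≠ f → F f e = 0 := by
        intro e he h1 h2
        by_contra h3
        rcases hFs f hf hfe e h3 with h | h | h
        exacts [hBK e h he, h1 h, h2 h]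
      -- On `K` away from `e₀` elimination only removes elements. At `e₀` the only possible new sign
      -- is `F f e₀ = 1 = Y e₀`, which keeps the product nonnegative.
      have hZK : ∀ e ∈ K, e ≠ e₀ → Z e = 0 ∨ Z e = X e := by
        intro e he h1
        by_cases h2 : e = f
        · left; rw [h2, hZf]
        · rcases hZs e with h | h | h
          exacts [Or.inl h, Or.inr h, Or.inl (h.trans (hFK e he h1 h2))]
      refine ih _ ?_ Z hZ ?_ ?_ rfl
      · rw [← hn]
        refine Set.ncard_lt_ncard ⟨?_, fun hsub => ?_⟩ ?_
        · rintro e ⟨⟨h1, h2⟩, h3⟩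
          refine ⟨⟨fun h4 => h1 ?_, h2⟩, h3⟩
          rcases hZK e h2 h3 with h | h
          exacts [h, h.trans h4]
        · exact (hsub ⟨⟨hXf, hf⟩, hfe⟩).1.1 hZf
        · exact (M.E.finite_toSet.subset (M.support_subset X hX)).subset
            (Set.sdiff_subset.trans Set.inter_subset_left)
      · intro e he
        rcases hZs e with h | h | h
        · exact absurd h he
        · exact hXB e (h ▸ he)
        · rcases hFs f hf hfe e (h ▸ he) with h | h | h
          · exact Or.inl h
          · exact Or.inr (h ▸ he₀)
          · exact Or.inr (h ▸ hf)
      · intro e he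
        by_cases h0 : e = e₀
        · subst h0
          rcases hZs e with h | h | h
          · rw [h, zero_mul]
          · rw [h]; exact hpos e he
          · rw [h, hF0 f hf hfe, hY0]; decide
        · rcases hZK e he h0 with h | h
          · rw [h, zero_mul]
          · rw [h]; exact hpos e he

/-- The circuit of `y` over `B` vanishes on `K`. Eliminating `y` against it moves the support into
`B ∪ K` without a new sign on `K`, and independence of `B` forces the result to meet `K`. -/
theorem SignsAgainst.exchange {K B : Set α} {Y : α → SignType}
    (hB : M.underlying.IsBasis B (M.underlying.E \ K)) (h : M.SignsAgainst K B Y)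
    {e y : α} (hy : y ∈ M.underlying.E \ K) (hyB : y ∉ B) :
    M.SignsAgainst K (insert y (B \ {e})) Y := by
  intro X hX hXs hpos f hf
  by_contra hXf
  by_cases hXy : X y = 0
  · refine hXf (h X hX (fun g hg => ?_) hpos f hf)
    rcases hXs g hg with (rfl | h1) | h1
    exacts [absurd hXy hg, Or.inl h1.1, Or.inr h1]
  · obtain ⟨C, hC, hCy, hCs⟩ := M.exists_isCircuit_of_mem_closure (s := -X y)
      (hB.subset_closure hy) hyB
      ((by decide : ∀ s : SignType, s ≠ 0 → -s ≠ 0) _ hXy)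
    have hCK : ∀ g ∈ K, C g = 0 := by
      intro g hg
      by_contra hCg
      rcases hCs g hCg with rfl | h1
      exacts [hy.2 hg, (hB.subset h1).2 hg]
    have hne : X ≠ -C := by
      rintro rfl
      exact hXf (by simp [hCK f hf])
    obtain ⟨Z, hZ, hZy, hZs⟩ := M.elimination_of_neg hX hC hne hXy (by rw [hCy, neg_neg])
    have hZB : ∀ g, Z g ≠ 0 → g ∈ B ∪ K := by
      intro g hg
      have hgy : g ≠ y := fun hgy => hg (hgy ▸ hZy)
      rcases hZs g with h1 | h1 | h1
      · exact absurd h1 hg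
      · rcases hXs g (h1 ▸ hg) with (h2 | h2) | h2
        exacts [absurd h2 hgy, Or.inl h2.1, Or.inr h2]
      · rcases hCs g (h1 ▸ hg) with h2 | h2
        exacts [absurd h2 hgy, Or.inl h2]
    obtain ⟨g, hg, hZg⟩ := M.exists_mem_of_subset_union hB.indep hZ hZB
    refine hZg (h Z hZ hZB (fun g hg => ?_) g hg)
    rcases hZs g with h1 | h1 | h1
    · rw [h1, zero_mul]
    · rw [h1]; exact hpos g hg
    · rw [h1, hCK g hg, zero_mul]

theorem SignsAgainst.of_isBasis {K B : Set α} {Y : α → SignType}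
    (hB : M.underlying.IsBasis B (M.underlying.E \ K)) (h : M.SignsAgainst K B Y) {J : Set α}
    (hJ : M.underlying.IsBasis J (M.underlying.E \ K)) : M.SignsAgainst K J Y := by
  induction hn : (B \ J).ncard using Nat.strong_induction_on generalizing B with
  | _ n ih =>
    by_cases hBJ : B ⊆ J
    · rwa [← hB.eq_of_subset_indep hJ.indep hBJ hJ.subset]
    · obtain ⟨e, heB, heJ⟩ := Set.not_subset.1 hBJ
      obtain ⟨y, ⟨hyJ, hyB⟩, hB'⟩ := hB.exchange hJ ⟨heB, heJ⟩
      refine ih _ ?_ hB' (SignsAgainst.exchange M hB h (hJ.subset hyJ) hyB) rfl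
      rw [← hn]
      refine Set.ncard_lt_ncard ⟨?_, fun hsub => ?_⟩
        ((M.E.finite_toSet.subset hB.indep.subset_ground).subset Set.sdiff_subset)
      · rintro z ⟨(rfl | hz), hzJ⟩
        exacts [absurd hyJ hzJ, ⟨hz.1, hzJ⟩]
      · rcases (hsub ⟨heB, heJ⟩).1 with h1 | h1
        exacts [hyB (h1 ▸ heB), h1.2 rfl]

/-- Every cocircuit of the underlying matroid supports a signed cocircuit. -/
theorem exists_isCocircuit_support_eq {K : Set α} (hK : M.underlying.IsCocircuit K) :
    ∃ Y, M.IsCocircuit Y ∧ Function.support Y = K := by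
  obtain ⟨B, hB⟩ := M.underlying.exists_isBasis (M.underlying.E \ K)
  obtain ⟨Y, hYK, hY⟩ := M.exists_signsAgainst hK hB
  have key : ∀ X, M.IsCircuit X → (∀ e, 0 ≤ X e * Y e) → ∀ e, X e * Y e = 0 := by
    intro X hX hpos e
    by_cases heK : e ∈ K
    · suffices h : X e = 0 by rw [h, zero_mul]
      by_contra hXe
      -- A circuit need not lie in `B ∪ K` for the chosen `B`. If it meets `K`, its part outside `K`
      -- is independent and extends to some basis `J` of the hyperplane, to which the property of
      -- `Y` transfers.
      have hI : M.underlying.Indep (Function.support X \ K) :=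
        (IsCircuit.isCircuit_support M hX).ssubset_indep
          ⟨Set.sdiff_subset, fun h => (h hXe).2 heK⟩
      obtain ⟨J, hJ, hIJ⟩ := hI.subset_isBasis_of_subset (X := M.underlying.E \ K)
        (Set.sdiff_subset_sdiff_left (M.support_subset X hX))
      refine hXe (SignsAgainst.of_isBasis M hB hY hJ X hX (fun g hg => ?_)
        (fun g _ => hpos g) e heK)
      by_cases hgK : g ∈ K
      exacts [Or.inr hgK, Or.inl (hIJ ⟨hg, hgK⟩)]
    · have : Y e = 0 := by
        by_contra h
        exact heK (hYK ▸ h)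
      rw [this, mul_zero]
  refine ⟨Y, ⟨hYK ▸ hK, fun X hX => ?_⟩, hYK⟩
  have s1 : ∀ s : SignType, s ≠ -1 → 0 ≤ s := by decide
  have s2 : ∀ s : SignType, s ≠ 1 → 0 ≤ -s := by decide
  constructor
  · rintro ⟨e, he⟩
    by_contra! hc
    have := key X hX (fun f => s1 _ (hc f)) e
    rw [he] at this
    revert this; decide
  · rintro ⟨e, he⟩
    by_contra! hc
    have := key (-X) (M.isCircuit_neg X hX)
      (fun f => by rw [Pi.neg_apply, neg_mul]; exact s2 _ (hc f)) e
    rw [Pi.neg_apply, neg_mul, he] at this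
    revert this; decide

theorem isCocircuit_neg {Y : α → SignType} (hY : M.IsCocircuit Y) : M.IsCocircuit (-Y) := by
  refine ⟨by rw [support_neg_eq]; exact hY.1, fun X hX => ?_⟩
  have h := hY.2 (-X) (M.isCircuit_neg X hX)
  simpa [SignedSet.Orthogonal] using h

/-! ### Orthogonality and painting. -/

/-- Two families of signed sets that satisfy the axioms of the signed circuits and the signed
cocircuits of an oriented matroid, in the form of orthogonality and a painting property. -/
structure IsDualPair (E : Finset α) (C D : (α → SignType) → Prop) : Prop where
  neg_left : ∀ X, C X → C (-X)
  neg_right : ∀ Y, D Y → D (-Y)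
  orthogonal : ∀ X Y, C X → D Y → (∀ e, 0 ≤ X e * Y e) → ∀ e, X e * Y e = 0
  painting : ∀ (P : Finset α) (W : Set α) (σ : α → SignType) (a : α), a ∈ P → a ∈ E →
    (∀ e ∈ P, σ e ≠ 0) → (∀ e ∈ P, e ∉ W) →
    (∃ X, C X ∧ X a * σ a = 1 ∧ (∀ e ∈ P, 0 ≤ X e * σ e) ∧ ∀ e, e ∉ P → e ∉ W → X e = 0) ∨
    (∃ Y, D Y ∧ Y a * σ a = 1 ∧ (∀ e ∈ P, 0 ≤ Y e * σ e) ∧ ∀ e ∈ W, Y e = 0)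

/-- Replacing `W` by the complement of `P ∪ W` interchanges the two alternatives of the painting.
This lets later statements on circuits serve for cocircuits as well. -/
theorem IsDualPair.symm {E : Finset α} {C D : (α → SignType) → Prop} (h : IsDualPair E C D) :
    IsDualPair E D C where
  neg_left := h.neg_right
  neg_right := h.neg_left
  orthogonal X Y hX hY hpos e := by
    rw [mul_comm]
    exact h.orthogonal Y X hY hX (fun e => by rw [mul_comm]; exact hpos e) e
  painting P W σ a ha haE hσ hPW := by
    rcases h.painting P {e | e ∉ P ∧ e ∉ W} σ a ha haE hσ (fun e he h' => h'.1 he) with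
      ⟨X, hX, h1, h2, h3⟩ | ⟨Y, hY, h1, h2, h3⟩
    · exact Or.inr ⟨X, hX, h1, h2, fun e he => h3 e (fun h' => hPW e h' he) fun h' => h'.2 he⟩
    · exact Or.inl ⟨Y, hY, h1, h2, fun e he he' => h3 e ⟨he, he'⟩⟩

/-- Whether `a` lies in the closure of `W ∩ M.E` decides between the alternatives; negation adjusts
the sign. -/
theorem painting_singleton (W : Set α) (a : α) (haE : a ∈ M.E) (haW : a ∉ W) {s : SignType}
    (hs : s ≠ 0) :
    (∃ X, M.IsCircuit X ∧ X a = s ∧ ∀ e, e ≠ a → e ∉ W → X e = 0) ∨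
    (∃ Y, M.IsCocircuit Y ∧ Y a = s ∧ ∀ e ∈ W, Y e = 0) := by
  by_cases hcl : a ∈ M.underlying.closure (W ∩ M.E)
  · obtain ⟨X, hX, hXa, hXs⟩ := M.exists_isCircuit_of_mem_closure hcl (fun h => haW h.1) hs
    refine Or.inl ⟨X, hX, hXa, fun e h1 h2 => ?_⟩
    by_contra h3
    rcases hXs e h3 with h | h
    exacts [h1 h, h2 h.1]
  · obtain ⟨K, hK, haK, hdis⟩ := Matroid.exists_isCocircuit_of_notMem_closure
      (N := M.underlying) haE Set.inter_subset_right hcl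
    obtain ⟨Y, hY, rfl⟩ := M.exists_isCocircuit_support_eq hK
    have hYW : ∀ e ∈ W, Y e = 0 := fun e he => by
      by_contra h
      exact Set.disjoint_left.1 hdis h ⟨he, hK.subset_ground h⟩
    have tri : ∀ s t : SignType, s ≠ 0 → t ≠ 0 → s = t ∨ -s = t := by decide
    rcases tri _ _ haK hs with h | h
    · exact Or.inr ⟨Y, hY, h, hYW⟩
    · exact Or.inr ⟨-Y, M.isCocircuit_neg hY, h, fun e he => by simp [hYW e he]⟩

theorem orthogonal_nonneg {X Y : α → SignType} (hX : M.IsCircuit X) (hY : M.IsCocircuit Y)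
    (hpos : ∀ e, 0 ≤ X e * Y e) (e : α) : X e * Y e = 0 := by
  have tri : ∀ s : SignType, 0 ≤ s → s = 0 ∨ s = 1 := by decide
  refine (tri _ (hpos e)).resolve_right fun h => ?_
  obtain ⟨f, hf⟩ := (hY.2 X hX).1 ⟨e, h⟩
  have := hpos f
  rw [hf] at this
  revert this; decide

/-- The circuits and cocircuits of an oriented matroid have the painting property. -/
theorem isDualPair : IsDualPair M.E M.IsCircuit M.IsCocircuit where
  neg_left := M.isCircuit_neg
  neg_right _ := M.isCocircuit_neg
  orthogonal _ _ := M.orthogonal_nonneg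
  painting P W σ a ha haE hσ hPW := by
    classical
    induction hn : P.card generalizing P W with
    | zero => simp [Finset.card_eq_zero.1 hn] at ha
    | succ n ih =>
      have sq : ∀ s : SignType, s ≠ 0 → s * s = 1 := by decide
      by_cases hP : P = {a}
      · subst hP
        rcases M.painting_singleton W a haE (hPW a ha) (hσ a ha) with
          ⟨X, hX, h1, h2⟩ | ⟨Y, hY, h1, h2⟩
        · refine Or.inl ⟨X, hX, by rw [h1, sq _ (hσ a ha)], fun e he => ?_, fun e he => h2 e ?_⟩
          · rw [Finset.mem_singleton.1 he, h1, sq _ (hσ a (Finset.mem_singleton_self a))]; decide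
          · simpa using he
        · refine Or.inr ⟨Y, hY, by rw [h1, sq _ (hσ a ha)], fun e he => ?_, h2⟩
          rw [Finset.mem_singleton.1 he, h1, sq _ (hσ a (Finset.mem_singleton_self a))]; decide
      · obtain ⟨b, hb, hba⟩ : ∃ b ∈ P, b ≠ a := by
          by_contra! h
          exact hP (Finset.eq_singleton_iff_unique_mem.2 ⟨ha, h⟩)
        have hcard : (P.erase b).card = n := by rw [Finset.card_erase_of_mem hb, hn]; rfl
        have ha' : a ∈ P.erase b := Finset.mem_erase.2 ⟨hba.symm, ha⟩
        have tri : ∀ s : SignType, 0 ≤ s ∨ s = -1 := by decide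
        -- With `b` outside both `P` and `W`, a circuit vanishes at `b` and is as required, while a
        -- cocircuit has an uncontrolled sign there.
        rcases ih (P.erase b) W ha' (fun e he => hσ e (Finset.mem_of_mem_erase he))
          (fun e he => hPW e (Finset.mem_of_mem_erase he)) hcard with
          ⟨X, hX, hX1, hX2, hX3⟩ | ⟨Y, hY, hY1, hY2, hY3⟩
        · refine Or.inl ⟨X, hX, hX1, fun e he => ?_,
            fun e he => hX3 e fun h => he (Finset.mem_of_mem_erase h)⟩
          by_cases heb : e = b
          · rw [heb, hX3 b (Finset.notMem_erase b P) (hPW b hb), zero_mul]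
          · exact hX2 e (Finset.mem_erase.2 ⟨heb, he⟩)
        -- With `b` moved into `W` the roles are reversed: only a circuit has an uncontrolled sign
        -- at `b`.
        rcases ih (P.erase b) (insert b W) ha'
            (fun e he => hσ e (Finset.mem_of_mem_erase he)) (fun e he h => by
            rcases h with h | h
            exacts [Finset.ne_of_mem_erase he h, hPW e (Finset.mem_of_mem_erase he) h]) hcard with
          ⟨X, hX, hX1, hX2, hX3⟩ | ⟨Y', hY', hY1', hY2', hY3'⟩
        · have hX3' : ∀ e, e ∉ P → e ∉ W → X e = 0 := fun e he heW =>
            hX3 e (fun h => he (Finset.mem_of_mem_erase h)) (by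
              rintro (h | h)
              exacts [he (h ▸ hb), heW h])
          rcases tri (X b * σ b) with hXb | hXb
          · refine Or.inl ⟨X, hX, hX1, fun e he => ?_, hX3'⟩
            by_cases heb : e = b
            · rwa [heb]
            · exact hX2 e (Finset.mem_erase.2 ⟨heb, he⟩)
          rcases tri (Y b * σ b) with hYb | hYb
          · refine Or.inr ⟨Y, hY, hY1, fun e he => ?_, hY3⟩
            by_cases heb : e = b
            · rwa [heb]
            · exact hY2 e (Finset.mem_erase.2 ⟨heb, he⟩)
          -- Both signs at `b` are wrong, hence equal. All products are then nonnegative, and the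
          -- one at `a` is nonzero.
          exfalso
          have s1 : ∀ r s t : SignType, 0 ≤ r * t → 0 ≤ s * t → t ≠ 0 → 0 ≤ r * s := by decide
          have s2 : ∀ r s t : SignType, r * t = s * t → t ≠ 0 → 0 ≤ r * s := by decide
          have s3 : ∀ r s t : SignType, r * t = 1 → s * t = 1 → r * s ≠ 0 := by decide
          refine s3 _ _ _ hX1 hY1 (M.orthogonal_nonneg hX hY (fun e => ?_) a)
          by_cases heb : e = b
          · rw [heb]; exact s2 _ _ _ (hXb.trans hYb.symm) (hσ b hb)
          by_cases heP : e ∈ P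
          · have := Finset.mem_erase.2 ⟨heb, heP⟩
            exact s1 _ _ _ (hX2 e this) (hY2 e this) (hσ e heP)
          by_cases heW : e ∈ W
          · rw [hY3 e heW, mul_zero]
          · rw [hX3' e heP heW, zero_mul]
        · refine Or.inr ⟨Y', hY', hY1', fun e he => ?_, fun e he => hY3' e (Or.inr he)⟩
          by_cases heb : e = b
          · rw [heb, hY3' b (Or.inl rfl), zero_mul]
          · exact hY2' e (Finset.mem_erase.2 ⟨heb, he⟩)

end Painting

/-! ### Activities in minors and the removal of the greatest element. -/

/-- `S` is the ground set of a minor, `Z` is deleted and `W` is contracted. -/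
structure IsMinorPartition {α : Type*} (S : Finset α) (Z W : Set α) : Prop where
  cover : ∀ e, e ∈ S ∨ e ∈ Z ∨ e ∈ W
  left : ∀ e ∈ S, e ∉ Z
  right : ∀ e ∈ S, e ∉ W
  disj : ∀ e ∈ Z, e ∉ W

theorem IsMinorPartition.symm {α : Type*} {S : Finset α} {Z W : Set α}
    (h : IsMinorPartition S Z W) : IsMinorPartition S W Z where
  cover e := by have := h.cover e; tauto
  left := h.right
  right := h.left
  disj e h1 h2 := h.disj e h2 h1

section Active

variable {α : Type*} [LinearOrder α]

/-- `a` is the least element of the trace on `S` of a member of `K` that vanishes on `Z` and has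
the signs of `σ` on its support in `S`. -/
def IsActive (K : (α → SignType) → Prop) (S : Finset α) (Z : Set α) (σ : α → SignType) (a : α) :
    Prop :=
  ∃ X, K X ∧ X a * σ a = 1 ∧ (∀ e ∈ S, 0 ≤ X e * σ e) ∧ (∀ e ∈ S, e < a → X e = 0) ∧
    ∀ e ∈ Z, X e = 0

variable {C D K : (α → SignType) → Prop} {E S T : Finset α} {Z W : Set α} {σ τ : α → SignType}
  {ω a b : α}

theorem IsMinorPartition.delete (h : IsMinorPartition (insert ω T) Z W) (hω : ω ∉ T) :
    IsMinorPartition T (insert ω Z) W where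
  cover e := by
    have := h.cover e
    simp only [Finset.mem_insert, Set.mem_insert_iff] at this ⊢
    tauto
  left e he := by
    rintro (h1 | h1)
    exacts [hω (h1 ▸ he), h.left e (Finset.mem_insert_of_mem he) h1]
  right e he := h.right e (Finset.mem_insert_of_mem he)
  disj e := by
    rintro (h1 | h1)
    exacts [h1 ▸ h.right ω (Finset.mem_insert_self _ _), h.disj e h1]

theorem IsMinorPartition.contract (h : IsMinorPartition (insert ω T) Z W) (hω : ω ∉ T) :
    IsMinorPartition T Z (insert ω W) :=
  (h.symm.delete hω).symm

theorem IsActive.congr (h : IsActive K S Z σ a) (ha : a ∈ S) (hστ : ∀ e ∈ S, σ e = τ e) :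
    IsActive K S Z τ a := by
  obtain ⟨X, hX, h1, h2, h3, h4⟩ := h
  exact ⟨X, hX, hστ a ha ▸ h1, fun e he => hστ e he ▸ h2 e he, h3, h4⟩

theorem isActive_congr (ha : a ∈ S) (hστ : ∀ e ∈ S, σ e = τ e) :
    IsActive K S Z σ a ↔ IsActive K S Z τ a :=
  ⟨fun h => h.congr ha hστ, fun h => h.congr ha fun e he => (hστ e he).symm⟩

theorem IsActive.of_delete (h : IsActive K T (insert ω Z) σ a) :
    IsActive K (insert ω T) Z σ a := by
  obtain ⟨X, hX, h1, h2, h3, h4⟩ := h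
  have hω : X ω = 0 := h4 ω (Set.mem_insert _ _)
  refine ⟨X, hX, h1, fun e he => ?_, fun e he hea => ?_, fun e he => h4 e (Or.inr he)⟩
  · rcases Finset.mem_insert.1 he with rfl | he
    · rw [hω, zero_mul]
    · exact h2 e he
  · rcases Finset.mem_insert.1 he with rfl | he
    exacts [hω, h3 e he hea]

theorem IsActive.to_contract (h : IsActive K (insert ω T) Z σ a) : IsActive K T Z σ a := by
  obtain ⟨X, hX, h1, h2, h3, h4⟩ := h
  exact ⟨X, hX, h1, fun e he => h2 e (Finset.mem_insert_of_mem he),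
    fun e he => h3 e (Finset.mem_insert_of_mem he), h4⟩

/-- The sign of a witness at `ω` is compatible with `σ ω` or with its opposite, and an element above
`a` does not disturb minimality. -/
theorem IsActive.of_contract (h : IsActive K T Z σ a) (hωa : a < ω)
    (hστ : ∀ e ∈ T, σ e = τ e) (ha : a ∈ T) (hω : τ ω = -σ ω) :
    IsActive K (insert ω T) Z σ a ∨ IsActive K (insert ω T) Z τ a := by
  obtain ⟨X, hX, h1, h2, h3, h4⟩ := h
  have h5 : ∀ e ∈ insert ω T, e < a → X e = 0 := fun e he hea => by
    rcases Finset.mem_insert.1 he with rfl | he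
    exacts [absurd hωa (not_lt.2 hea.le), h3 e he hea]
  have s1 : ∀ s t : SignType, 0 ≤ s * t ∨ 0 ≤ s * -t := by decide
  rcases s1 (X ω) (σ ω) with h6 | h6
  · refine Or.inl ⟨X, hX, h1, fun e he => ?_, h5, h4⟩
    rcases Finset.mem_insert.1 he with rfl | he
    exacts [h6, h2 e he]
  · refine Or.inr ⟨X, hX, hστ a ha ▸ h1, fun e he => ?_, h5, h4⟩
    rcases Finset.mem_insert.1 he with rfl | he
    exacts [hω ▸ h6, hστ e he ▸ h2 e he]

theorem sign_mul_nonneg {r s t : SignType} (h1 : 0 ≤ r * t) (h2 : 0 ≤ s * t) (ht : t ≠ 0) :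
    0 ≤ r * s := by
  revert r s t; decide

theorem sign_mul_ne_zero {r s t : SignType} (h1 : r * t = 1) (h2 : s * t = 1) : r * s ≠ 0 := by
  revert r s t; decide

/-- If `a` is not active in a minor, a member of the other family witnesses it. -/
theorem exists_of_not_isActive (hCD : IsDualPair E C D) (hp : IsMinorPartition T Z W)
    (hσ : ∀ e, σ e ≠ 0) (haT : a ∈ T) (haE : a ∈ E) (h : ¬ IsActive C T Z σ a) :
    ∃ Y, D Y ∧ Y a * σ a = 1 ∧ (∀ e ∈ T, a ≤ e → 0 ≤ Y e * σ e) ∧ ∀ e ∈ W, Y e = 0 := by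
  rcases hCD.painting (T.filter (a ≤ ·)) W σ a (by simp [haT]) haE (fun e _ => hσ e)
    (fun e he => hp.right e (Finset.mem_filter.1 he).1) with
    ⟨V, hV, h1, h2, h3⟩ | ⟨Y, hY, h1, h2, h3⟩
  · refine absurd ?_ h
    have h5 : ∀ e ∈ T, e < a → V e = 0 := fun e he hea =>
      h3 e (by simp [hea]) (hp.right e he)
    refine ⟨V, hV, h1, fun e he => ?_, h5, fun e he => h3 e ?_ (hp.disj e he)⟩
    · rcases lt_or_ge e a with hea | hea
      · rw [h5 e he hea, zero_mul]
      · exact h2 e (by simp [he, hea])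
    · exact fun h => hp.left e (Finset.mem_filter.1 h).1 he
  · exact ⟨Y, hY, h1, fun e he hae => h2 e (by simp [he, hae]), h3⟩

/-- This replaces an elimination of `ω` between the two witnesses. If `a` fails in the deletion,
painting gives a `Y` whose sign at `ω` must oppose that of `X`. If `b` fails too, `X'` is nonzero at
`ω`, again opposite to `X`, so it agrees with `Y` there. By `a ≤ b` all other products of `X'` and
`Y` are nonnegative, against orthogonality. -/
theorem IsActive.min_delete (hCD : IsDualPair E C D) (hp : IsMinorPartition (insert ω T) Z W)
    (hω : ω ∉ T) (hσ : ∀ e, σ e ≠ 0) (hστ : ∀ e ∈ T, σ e = τ e) (hτ : τ ω = -σ ω)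
    (ha : IsActive C (insert ω T) Z σ a) (haT : a ∈ T) (haE : a ∈ E)
    (hb : IsActive C (insert ω T) Z τ b) (hbT : b ∈ T) (hab : a ≤ b) :
    IsActive C T (insert ω Z) σ a ∨ IsActive C T (insert ω Z) σ b := by
  by_contra! hc
  obtain ⟨hca, hcb⟩ := hc
  obtain ⟨X, hX, hX1, hX2, hX3, hX4⟩ := ha
  obtain ⟨X', hX', hX1', hX2', hX3', hX4'⟩ := hb
  obtain ⟨Y, hY, h1, hYT, h3⟩ := exists_of_not_isActive hCD (hp.delete hω) hσ haT haE hca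
  have hXY : ∀ e, e ≠ ω → 0 ≤ X e * Y e := by
    intro e heω
    rcases hp.cover e with he | he | he
    · rcases lt_or_ge e a with hea | hea
      · rw [hX3 e he hea, zero_mul]
      · exact sign_mul_nonneg (hX2 e he)
          (hYT e ((Finset.mem_insert.1 he).resolve_left heω) hea) (hσ e)
    · rw [hX4 e he, zero_mul]
    · rw [h3 e he, mul_zero]
  have hXY' : ∀ e, e ≠ ω → 0 ≤ X' e * Y e := by
    intro e heω
    rcases hp.cover e with he | he | he
    · rcases lt_or_ge e b with hea | hea
      · rw [hX3' e he hea, zero_mul]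
      · have heT := (Finset.mem_insert.1 he).resolve_left heω
        have := hX2' e he
        rw [← hστ e heT] at this
        exact sign_mul_nonneg this (hYT e heT (hab.trans hea)) (hσ e)
    · rw [hX4' e he, zero_mul]
    · rw [h3 e he, mul_zero]
  have hneg : ¬ 0 ≤ X ω * Y ω := fun h0 => by
    refine sign_mul_ne_zero hX1 h1 (hCD.orthogonal X Y hX hY (fun e => ?_) a)
    by_cases heω : e = ω
    exacts [heω ▸ h0, hXY e heω]
  have hX'ω0 : X' ω ≠ 0 := fun h0 => by
    refine hcb ⟨X', hX', hστ b hbT ▸ hX1', fun e he => hστ e he ▸ hX2' e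
      (Finset.mem_insert_of_mem he), fun e he => hX3' e (Finset.mem_insert_of_mem he), ?_⟩
    rintro e (rfl | he)
    exacts [h0, hX4' e he]
  have hX'ω : X' ω * Y ω = 1 := by
    have hXω := hX2 ω (Finset.mem_insert_self _ _)
    have hXω' := hX2' ω (Finset.mem_insert_self _ _)
    have s1 : ∀ r s t : SignType, ¬ 0 ≤ r * s → 0 ≤ r * t → t ≠ 0 → s = -t := by decide
    have s2 : ∀ r t : SignType, r ≠ 0 → 0 ≤ r * t → t ≠ 0 → r * t = 1 := by decide
    have s3 := s1 _ _ _ hneg hXω (hσ ω)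
    rw [s3]
    rw [hτ] at hXω'
    exact s2 _ _ hX'ω0 hXω' ((by decide : ∀ s : SignType, s ≠ 0 → -s ≠ 0) _ (hσ ω))
  have h0 := hCD.orthogonal X' Y hX' hY (fun e => by
    by_cases heω : e = ω
    · rw [heω, hX'ω]; decide
    · exact hXY' e heω) ω
  rw [hX'ω] at h0
  exact absurd h0 (by decide)

/-- A witness valid for `σ` but not for `τ` has the sign `σ ω` at `ω`. Two such witnesses, one from
each family, would have nonnegative products everywhere and a nonzero one at `ω`. -/
theorem not_isActive_isActive (hCD : IsDualPair E C D)
    (hp : IsMinorPartition (insert ω T) Z W) (hστ : ∀ e ∈ T, σ e = τ e) (hτ : τ ω = -σ ω)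
    (hσ : ∀ e, σ e ≠ 0) (haT : a ∈ T) (hbT : b ∈ T)
    (ha : IsActive C (insert ω T) Z σ a) (ha' : ¬ IsActive C (insert ω T) Z τ a)
    (hb : IsActive D (insert ω T) W σ b) (hb' : ¬ IsActive D (insert ω T) W τ b) : False := by
  obtain ⟨X, hX, hX1, hX2, hX3, hX4⟩ := ha
  obtain ⟨Y, hY, hY1, hY2, hY3, hY4⟩ := hb
  have key : ∀ V : α → SignType, (∀ e ∈ insert ω T, 0 ≤ V e * σ e) →
      ¬ (∀ e ∈ insert ω T, 0 ≤ V e * τ e) → V ω * σ ω = 1 := by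
    intro V h1 h2
    by_contra h3
    refine h2 fun e he => ?_
    rcases Finset.mem_insert.1 he with rfl | heT
    · rw [hτ]
      have := h1 e he
      revert this h3
      generalize V e = s; generalize σ e = t
      revert s t; decide
    · exact hστ e heT ▸ h1 e he
  have hXω := key X hX2 fun h => ha' ⟨X, hX, hστ a haT ▸ hX1, h, hX3, hX4⟩
  have hYω := key Y hY2 fun h => hb' ⟨Y, hY, hστ b hbT ▸ hY1, h, hY3, hY4⟩
  refine sign_mul_ne_zero hXω hYω (hCD.orthogonal X Y hX hY (fun e => ?_) ω)
  rcases hp.cover e with he | he | he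
  · exact sign_mul_nonneg (hX2 e he) (hY2 e he) (hσ e)
  · rw [hX4 e he, zero_mul]
  · rw [hY4 e he, mul_zero]

/-- On the elements below the greatest element `ω` of a minor, either `ω` acts as a deleted element
with the signs of `σ` and as a contracted element with the signs of `τ`, or conversely. -/
theorem isActive_dichotomy (hCD : IsDualPair E C D) (hp : IsMinorPartition (insert ω T) Z W)
    (hTE : ∀ e ∈ T, e ∈ E) (hω : ∀ e ∈ T, e < ω) (hσ : ∀ e, σ e ≠ 0)
    (hτ0 : ∀ e, τ e ≠ 0) (hστ : ∀ e ∈ T, σ e = τ e) (hτ : τ ω = -σ ω) :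
    (∀ a ∈ T, (IsActive C (insert ω T) Z σ a ↔ IsActive C T (insert ω Z) σ a) ∧
      (IsActive C (insert ω T) Z τ a ↔ IsActive C T Z σ a) ∧
      (IsActive D (insert ω T) W σ a ↔ IsActive D T W σ a) ∧
      (IsActive D (insert ω T) W τ a ↔ IsActive D T (insert ω W) σ a)) ∨
    (∀ a ∈ T, (IsActive C (insert ω T) Z τ a ↔ IsActive C T (insert ω Z) σ a) ∧
      (IsActive C (insert ω T) Z σ a ↔ IsActive C T Z σ a) ∧
      (IsActive D (insert ω T) W τ a ↔ IsActive D T W σ a) ∧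
      (IsActive D (insert ω T) W σ a ↔ IsActive D T (insert ω W) σ a)) := by
  have hωT : ω ∉ T := fun h => lt_irrefl _ (hω ω h)
  have hστ' : ∀ e ∈ T, τ e = σ e := fun e he => (hστ e he).symm
  have hτ' : σ ω = -τ ω := by rw [hτ, neg_neg]
  have basic : ∀ {K : (α → SignType) → Prop} {Z : Set α}, ∀ a ∈ T,
      (IsActive K T (insert ω Z) σ a → IsActive K (insert ω T) Z σ a ∧
        IsActive K (insert ω T) Z τ a) ∧
      ((IsActive K (insert ω T) Z σ a ∨ IsActive K (insert ω T) Z τ a) ↔ IsActive K T Z σ a) := by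
    intro K Z a ha
    refine ⟨fun h => ⟨h.of_delete, (h.congr ha hστ).of_delete⟩, ?_,
      fun h => h.of_contract (hω a ha) hστ ha hτ⟩
    rintro (h | h)
    exacts [h.to_contract, h.to_contract.congr ha hστ']
  have cmp : ∀ {C D : (α → SignType) → Prop} {Z W : Set α}, IsDualPair E C D →
      IsMinorPartition (insert ω T) Z W → ∀ a ∈ T, ∀ b ∈ T,
      IsActive C (insert ω T) Z σ a → IsActive C (insert ω T) Z τ b →
      IsActive C T (insert ω Z) σ a ∨ IsActive C T (insert ω Z) σ b := by
    intro C D Z W hCD hp a ha b hb h1 h2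
    rcases le_total a b with hab | hba
    · exact h1.min_delete hCD hp hωT hσ hστ hτ ha (hTE a ha) h2 hb hab
    · rcases h2.min_delete hCD hp hωT hτ0 hστ' hτ' hb (hTE b hb) h1 ha hba with h | h
      exacts [Or.inr (h.congr hb hστ'), Or.inl (h.congr ha hστ')]
  have mixed := fun a ha b hb => not_isActive_isActive (a := a) (b := b) hCD hp hστ hτ hσ ha hb
  have mixed' := fun a ha b hb => not_isActive_isActive (σ := τ) (τ := σ) (a := a) (b := b) hCD hp
    hστ' hτ' hτ0 ha hb
  have cC := cmp hCD hp
  have cD := cmp hCD.symm hp.symm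
  have bC := basic (K := C) (Z := Z)
  have bD := basic (K := D) (Z := W)
  clear cmp basic
  -- Given these inclusions, the smaller active set of each family is the intersection of the two,
  -- where `ω` is forced to vanish, and the larger is the union, where `ω` is ignored.
  by_cases h : (∀ a ∈ T, IsActive C (insert ω T) Z σ a → IsActive C (insert ω T) Z τ a) ∧
      (∀ a ∈ T, IsActive D (insert ω T) W τ a → IsActive D (insert ω T) W σ a)
  · left
    intro a ha
    have h1 := h.1 a ha
    have h2 := h.2 a ha
    have h3 := bC a ha
    have h4 := bD a ha
    have h5 := cC a ha a ha
    have h6 := cD a ha a ha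
    clear mixed mixed' cC cD bC bD
    grind
  · have h' : (∀ a ∈ T, IsActive C (insert ω T) Z τ a → IsActive C (insert ω T) Z σ a) ∧
        (∀ a ∈ T, IsActive D (insert ω T) W σ a → IsActive D (insert ω T) W τ a) := by
      -- If both pairs of inclusions fail, either one family has incomparable active sets, or both
      -- families have an excess for the same sign vector.
      by_contra h'
      rw [not_and_or] at h h'
      push Not at h h'
      rcases h with ⟨a, ha, h1, h2⟩ | ⟨a, ha, h1, h2⟩ <;>
        rcases h' with ⟨b, hb, h3, h4⟩ | ⟨b, hb, h3, h4⟩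
      · have := cC a ha b hb h1 h3
        have := bC a ha
        have := bC b hb
        tauto
      · exact mixed a ha b hb h1 h2 h3 h4
      · exact mixed' b hb a ha h3 h4 h1 h2
      · have := cD b hb a ha h3 h1
        have := bD a ha
        have := bD b hb
        tauto
    right
    intro a ha
    have h1 := h'.1 a ha
    have h2 := h'.2 a ha
    have h3 := bC a ha
    have h4 := bD a ha
    have h5 := cC a ha a ha
    have h6 := cD a ha a ha
    clear mixed mixed' cC cD bC bD
    grind

/-- Some member of `K` contains `ω` and vanishes on `T` and on `Z`. -/
def IsMinorLoop (K : (α → SignType) → Prop) (T : Finset α) (Z : Set α) (ω : α) : Prop :=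
  ∃ X, K X ∧ X ω ≠ 0 ∧ (∀ e ∈ T, X e = 0) ∧ ∀ e ∈ Z, X e = 0

/-- For the greatest element, being least means that the trace is `{ω}`; closure under negation
makes its sign irrelevant. -/
theorem isActive_max_iff (hK : ∀ X, K X → K (-X)) (hω : ∀ e ∈ T, e < ω) (hσ : σ ω ≠ 0) :
    IsActive K (insert ω T) Z σ ω ↔ IsMinorLoop K T Z ω := by
  constructor
  · rintro ⟨X, hX, h1, -, h3, h4⟩
    exact ⟨X, hX, fun h => by rw [h, zero_mul] at h1; exact absurd h1 (by decide),
      fun e he => h3 e (Finset.mem_insert_of_mem he) (hω e he), h4⟩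
  · rintro ⟨X, hX, h1, h2, h3⟩
    have key : ∀ V : α → SignType, K V → V ω * σ ω = 1 → (∀ e ∈ T, V e = 0) →
        (∀ e ∈ Z, V e = 0) → IsActive K (insert ω T) Z σ ω := by
      intro V hV hVω hVT hVZ
      refine ⟨V, hV, hVω, fun e he => ?_, fun e he hea => ?_, hVZ⟩
      · rcases Finset.mem_insert.1 he with rfl | he
        · rw [hVω]; decide
        · rw [hVT e he, zero_mul]
      · rcases Finset.mem_insert.1 he with rfl | he
        exacts [absurd hea (lt_irrefl _), hVT e he]
    have tri : ∀ s t : SignType, s ≠ 0 → t ≠ 0 → s * t = 1 ∨ -s * t = 1 := by decide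
    rcases tri _ _ h1 hσ with h | h
    · exact key X hX h h2 h3
    · exact key (-X) (hK X hX) h (fun e he => by simp [h2 e he]) fun e he => by simp [h3 e he]

theorem IsMinorLoop.eq_zero (hCD : IsDualPair E C D) (hp : IsMinorPartition (insert ω T) Z W)
    (h : IsMinorLoop C T Z ω) {Y : α → SignType} (hY : D Y) (hYW : ∀ e ∈ W, Y e = 0) :
    Y ω = 0 := by
  obtain ⟨X, hX, h1, h2, h3⟩ := h
  by_contra hYω
  have h0 : ∀ e, e ≠ ω → X e * Y e = 0 := fun e heω => by
    rcases hp.cover e with he | he | he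
    · rw [h2 e ((Finset.mem_insert.1 he).resolve_left heω), zero_mul]
    · rw [h3 e he, zero_mul]
    · rw [hYW e he, mul_zero]
  have sgn : ∀ s t : SignType, s ≠ 0 → t ≠ 0 → (0 ≤ s * t ∨ 0 ≤ -s * t) ∧ s * t ≠ 0 ∧
      -s * t ≠ 0 := by decide
  obtain ⟨h4 | h4, h5, h6⟩ := sgn _ _ h1 hYω
  · refine h5 (hCD.orthogonal X Y hX hY (fun e => ?_) ω)
    by_cases heω : e = ω
    exacts [heω ▸ h4, (h0 e heω).ge]
  · refine h6 (hCD.orthogonal (-X) Y (hCD.neg_left X hX) hY (fun e => ?_) ω)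
    by_cases heω : e = ω
    · exact heω ▸ h4
    · rw [Pi.neg_apply, neg_mul, h0 e heω]; decide

theorem IsMinorLoop.not_isMinorLoop (hCD : IsDualPair E C D)
    (hp : IsMinorPartition (insert ω T) Z W) (h : IsMinorLoop C T Z ω) :
    ¬ IsMinorLoop D T W ω := by
  rintro ⟨Y, hY, h1, h2, h3⟩
  exact h1 (h.eq_zero hCD hp hY h3)

theorem IsMinorLoop.isActive_right_iff (hCD : IsDualPair E C D)
    (hp : IsMinorPartition (insert ω T) Z W) (h : IsMinorLoop C T Z ω) (hω : ∀ e ∈ T, e < ω) :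
    IsActive D (insert ω T) W σ a ↔ IsActive D T W σ a := by
  refine ⟨IsActive.to_contract, ?_⟩
  rintro ⟨Y, hY, h1, h2, h3, h4⟩
  have hYω := h.eq_zero hCD hp hY h4
  refine ⟨Y, hY, h1, fun e he => ?_, fun e he hea => ?_, h4⟩
  · rcases Finset.mem_insert.1 he with rfl | he
    · rw [hYω, zero_mul]
    · exact h2 e he
  · rcases Finset.mem_insert.1 he with rfl | he
    exacts [hYω, h3 e he hea]

/-- A witness may contain the loop `ω` and so cannot simply be reused. Instead, a member of `D`
obstructing activity in the deletion vanishes at `ω`, hence also contradicts the given witness. -/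
theorem IsMinorLoop.isActive_left_iff (hCD : IsDualPair E C D)
    (hp : IsMinorPartition (insert ω T) Z W) (h : IsMinorLoop C T Z ω) (hω : ω ∉ T)
    (hσ : ∀ e, σ e ≠ 0) (haT : a ∈ T) (haE : a ∈ E) :
    IsActive C (insert ω T) Z σ a ↔ IsActive C T (insert ω Z) σ a := by
  refine ⟨?_, IsActive.of_delete⟩
  rintro ⟨X, hX, hX1, hX2, hX3, hX4⟩
  by_contra hca
  obtain ⟨Y, hY, h1, h2, h3⟩ := exists_of_not_isActive hCD (hp.delete hω) hσ haT haE hca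
  refine sign_mul_ne_zero hX1 h1 (hCD.orthogonal X Y hX hY (fun e => ?_) a)
  rcases hp.cover e with he | he | he
  · rcases lt_or_ge e a with hea | hea
    · rw [hX3 e he hea, zero_mul]
    · rcases Finset.mem_insert.1 he with rfl | heT
      · rw [h.eq_zero hCD hp hY h3, mul_zero]
      · exact sign_mul_nonneg (hX2 e he) (h2 e heT hea) (hσ e)
  · rw [hX4 e he, zero_mul]
  · rw [h3 e he, mul_zero]

end Active

/-! ### Recursion for the activity sum. -/

section Sums

variable {α : Type*} [LinearOrder α] {R : Type*} [CommRing R]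
variable {C D K : (α → SignType) → Prop} {E S T A : Finset α} {Z W : Set α} {ω a : α}

/-- The sign vector that is negative on `A`. -/
def reorientSign (A : Finset α) (e : α) : SignType := if e ∈ A then -1 else 1

theorem reorientSign_ne_zero (A : Finset α) (e : α) : reorientSign A e ≠ 0 := by
  unfold reorientSign
  split_ifs <;> decide

theorem reorientSign_insert_of_ne (h : a ≠ ω) :
    reorientSign A a = reorientSign (insert ω A) a := by
  simp [reorientSign, h]

theorem reorientSign_insert_self (h : ω ∉ A) :
    reorientSign (insert ω A) ω = -reorientSign A ω := by
  simp [reorientSign, h]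

/-- The active elements of a reorientation of a minor on `S`. -/
noncomputable def activeSet (K : (α → SignType) → Prop) (S : Finset α) (Z : Set α)
    (A : Finset α) : Finset α :=
  open scoped Classical in S.filter fun a => IsActive K S Z (reorientSign A) a

theorem mem_activeSet : a ∈ activeSet K S Z A ↔ a ∈ S ∧ IsActive K S Z (reorientSign A) a := by
  classical
  simp [activeSet]

theorem activeSet_subset : activeSet K S Z A ⊆ S := fun _ h => (mem_activeSet.1 h).1

/-- The monomial that records the activities `P` and `Q` of the reorientation on `A`. -/
def activityTerm (x u y v : R) (P Q A : Finset α) : R :=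
  x ^ (P \ A).card * u ^ (P ∩ A).card * y ^ (Q \ A).card * v ^ (Q ∩ A).card

theorem activityTerm_comm (x u y v : R) (P Q A : Finset α) :
    activityTerm x u y v P Q A = activityTerm y v x u Q P A := by
  unfold activityTerm
  ring

theorem activityTerm_insert (x u y v : R) {P Q : Finset α} (hP : ω ∉ P) (hQ : ω ∉ Q) :
    activityTerm x u y v P Q (insert ω A) = activityTerm x u y v P Q A := by
  have h : ∀ {F : Finset α}, ω ∉ F → F \ insert ω A = F \ A ∧ F ∩ insert ω A = F ∩ A := by
    intro F hF
    refine ⟨?_, Finset.inter_insert_of_notMem hF⟩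
    rw [Finset.sdiff_insert, Finset.erase_eq_of_notMem]
    simp [hF]
  simp [activityTerm, h hP, h hQ]

theorem activityTerm_insert_right (x u y v : R) {P Q : Finset α} (hQ : ω ∉ Q) (hA : ω ∉ A) :
    activityTerm x u y v P (insert ω Q) A = y * activityTerm x u y v P Q A := by
  have h1 : (insert ω Q \ A).card = (Q \ A).card + 1 := by
    rw [Finset.insert_sdiff_of_notMem _ hA, Finset.card_insert_of_notMem (by simp [hQ])]
  have h2 : insert ω Q ∩ A = Q ∩ A := Finset.insert_inter_of_notMem hA
  rw [activityTerm, activityTerm, h1, h2]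
  ring

theorem activityTerm_insert_right_insert (x u y v : R) {P Q : Finset α} (hP : ω ∉ P)
    (hQ : ω ∉ Q) :
    activityTerm x u y v P (insert ω Q) (insert ω A) = v * activityTerm x u y v P Q A := by
  have h1 : (insert ω Q ∩ insert ω A).card = (Q ∩ A).card + 1 := by
    rw [← Finset.insert_inter_distrib, Finset.card_insert_of_notMem (by simp [hQ])]
  have h2 : insert ω Q \ insert ω A = Q \ A := by
    ext e
    simp only [Finset.mem_sdiff, Finset.mem_insert]
    by_cases h : e = ω
    · simp [h, hQ]
    · simp [h]
  have h3 := activityTerm_insert x u y v (A := A) hP hQ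
  simp only [activityTerm] at h3 ⊢
  rw [h1, h2]
  have h4 : P \ insert ω A = P \ A := by
    rw [Finset.sdiff_insert, Finset.erase_eq_of_notMem]
    simp [hP]
  rw [h4, Finset.inter_insert_of_notMem hP]
  ring

/-- The sum of the activity monomials of all reorientations of a minor on `S`. -/
noncomputable def activitySum (C D : (α → SignType) → Prop) (S : Finset α) (Z W : Set α)
    (x u y v : R) : R :=
  ∑ A ∈ S.powerset, activityTerm x u y v (activeSet D S W A) (activeSet C S Z A) A

theorem activitySum_comm (x u y v : R) :
    activitySum C D S Z W x u y v = activitySum D C S W Z y v x u :=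
  Finset.sum_congr rfl fun _ _ => activityTerm_comm _ _ _ _ _ _ _

/-- A loop is active in both reorientations of the pair: outside `A` it contributes `y`, inside
`insert ω A` it contributes `v`. -/
theorem activitySum_loop (hCD : IsDualPair E C D) (hp : IsMinorPartition (insert ω T) Z W)
    (hTE : ∀ e ∈ T, e ∈ E) (hω : ∀ e ∈ T, e < ω) (h : IsMinorLoop C T Z ω) (x u y v : R) :
    activitySum C D (insert ω T) Z W x u y v =
      (y + v) * activitySum C D T (insert ω Z) W x u y v := by
  have hωT : ω ∉ T := fun h => lt_irrefl _ (hω ω h)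
  have hD : ∀ B : Finset α, ω ∉ activeSet D (insert ω T) W B := fun B hB =>
    h.not_isMinorLoop hCD hp
      ((isActive_max_iff hCD.neg_right hω (reorientSign_ne_zero B ω)).1 (mem_activeSet.1 hB).2)
  rw [activitySum, Finset.sum_powerset_insert hωT, ← Finset.sum_add_distrib, activitySum,
    Finset.mul_sum]
  refine Finset.sum_congr rfl fun A hA => ?_
  have hAT := Finset.mem_powerset.1 hA
  have hωA : ω ∉ A := fun h => hωT (hAT h)
  have key : ∀ B : Finset α, (∀ e ∈ T, reorientSign A e = reorientSign B e) →
      activeSet D (insert ω T) W B = activeSet D T W A ∧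
      activeSet C (insert ω T) Z B = insert ω (activeSet C T (insert ω Z) A) := by
    intro B hB
    constructor
    · ext a
      by_cases ha : a = ω
      · subst ha
        exact iff_of_false (hD B) fun h => hωT (activeSet_subset h)
      · simp only [mem_activeSet, Finset.mem_insert, ha, false_or]
        refine and_congr_right fun haT => ?_
        rw [h.isActive_right_iff hCD hp hω, isActive_congr haT hB]
    · ext a
      by_cases ha : a = ω
      · subst ha
        simp only [mem_activeSet, Finset.mem_insert, true_or, true_and, iff_true]
        exact (isActive_max_iff hCD.neg_left hω (reorientSign_ne_zero B a)).2 h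
      · simp only [mem_activeSet, Finset.mem_insert, ha, false_or]
        refine and_congr_right fun haT => ?_
        rw [h.isActive_left_iff hCD hp hωT (reorientSign_ne_zero B) haT (hTE a haT),
          isActive_congr haT hB]
  obtain ⟨h1, h2⟩ := key A fun _ _ => rfl
  obtain ⟨h3, h4⟩ := key (insert ω A) fun e he => reorientSign_insert_of_ne (hω e he).ne
  have hP : ω ∉ activeSet D T W A := fun h => hωT (activeSet_subset h)
  have hQ : ω ∉ activeSet C T (insert ω Z) A := fun h => hωT (activeSet_subset h)
  rw [h1, h2, h3, h4, activityTerm_insert_right _ _ _ _ hQ hωA,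
    activityTerm_insert_right_insert _ _ _ _ hP hQ]
  ring

theorem activitySum_coloop (hCD : IsDualPair E C D) (hp : IsMinorPartition (insert ω T) Z W)
    (hTE : ∀ e ∈ T, e ∈ E) (hω : ∀ e ∈ T, e < ω) (h : IsMinorLoop D T W ω) (x u y v : R) :
    activitySum C D (insert ω T) Z W x u y v =
      (x + u) * activitySum C D T Z (insert ω W) x u y v := by
  rw [activitySum_comm, activitySum_loop hCD.symm hp.symm hTE hω h, activitySum_comm]

theorem activitySum_delete_contract (hCD : IsDualPair E C D)
    (hp : IsMinorPartition (insert ω T) Z W) (hTE : ∀ e ∈ T, e ∈ E) (hω : ∀ e ∈ T, e < ω)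
    (hl : ¬ IsMinorLoop C T Z ω) (hc : ¬ IsMinorLoop D T W ω) (x u y v : R) :
    activitySum C D (insert ω T) Z W x u y v =
      activitySum C D T (insert ω Z) W x u y v + activitySum C D T Z (insert ω W) x u y v := by
  have hωT : ω ∉ T := fun h => lt_irrefl _ (hω ω h)
  rw [activitySum, Finset.sum_powerset_insert hωT, ← Finset.sum_add_distrib, activitySum,
    activitySum, ← Finset.sum_add_distrib]
  refine Finset.sum_congr rfl fun A hA => ?_
  have hAT := Finset.mem_powerset.1 hA
  have hωA : ω ∉ A := fun h => hωT (hAT h)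
  have hD : ∀ B : Finset α, ω ∉ activeSet D (insert ω T) W B := fun B hB =>
    hc ((isActive_max_iff hCD.neg_right hω (reorientSign_ne_zero B ω)).1 (mem_activeSet.1 hB).2)
  have hC : ∀ B : Finset α, ω ∉ activeSet C (insert ω T) Z B := fun B hB =>
    hl ((isActive_max_iff hCD.neg_left hω (reorientSign_ne_zero B ω)).1 (mem_activeSet.1 hB).2)
  have hext : ∀ {K : (α → SignType) → Prop} {Z Z' : Set α} {B : Finset α},
      ω ∉ activeSet K (insert ω T) Z B →
      (∀ a ∈ T, (IsActive K (insert ω T) Z (reorientSign B) a ↔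
        IsActive K T Z' (reorientSign A) a)) →
      activeSet K (insert ω T) Z B = activeSet K T Z' A := by
    intro K Z Z' B h1 h2
    ext a
    by_cases ha : a = ω
    · subst ha
      exact iff_of_false h1 fun h => hωT (activeSet_subset h)
    · simp only [mem_activeSet, Finset.mem_insert, ha, false_or]
      exact and_congr_right (h2 a)
  rw [activityTerm_insert _ _ _ _ (hD _) (hC _)]
  -- Which member of the pair plays the deletion depends on `A`, but only the sum of the two terms
  -- matters.
  rcases isActive_dichotomy hCD hp hTE hω (reorientSign_ne_zero A)
    (reorientSign_ne_zero (insert ω A)) (fun e he => reorientSign_insert_of_ne (hω e he).ne)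
    (reorientSign_insert_self hωA) with h | h
  · rw [hext (hC A) fun a ha => (h a ha).1, hext (hC (insert ω A)) fun a ha => (h a ha).2.1,
      hext (hD A) fun a ha => (h a ha).2.2.1, hext (hD (insert ω A)) fun a ha => (h a ha).2.2.2]
  · rw [hext (hC (insert ω A)) fun a ha => (h a ha).1, hext (hC A) fun a ha => (h a ha).2.1,
      hext (hD (insert ω A)) fun a ha => (h a ha).2.2.1, hext (hD A) fun a ha => (h a ha).2.2.2,
      add_comm]

end Sums

/-! ### Recursion for the rank generating sum. -/

theorem coe_rank {α : Type*} (M : OrientedMatroid α) (B : Finset α) :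
    (M.rank B : ℕ∞) = M.underlying.eRk B :=
  ENat.natCast_toNat (((M.underlying.eRk_le_encard _).trans_lt
    B.finite_toSet.encard_lt_top).ne)

theorem rank_mono {α : Type*} (M : OrientedMatroid α) {B B' : Finset α} (h : B ⊆ B') :
    M.rank B ≤ M.rank B' := by
  rw [← Nat.cast_le (α := ℕ∞), coe_rank, coe_rank]
  exact M.underlying.eRk_mono (Finset.coe_subset.2 h)

section Rank

variable {α : Type*} [DecidableEq α] (M : OrientedMatroid α) {R : Type*} [CommRing R]
  {S T V : Finset α} {ω : α}

/-- Together with `rank_mono` this makes the truncated subtractions in `rankSum` exact. -/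
theorem rank_union_le (B V : Finset α) : M.rank (B ∪ V) ≤ B.card + M.rank V := by
  rw [← Nat.cast_le (α := ℕ∞), Nat.cast_add, coe_rank, coe_rank, Finset.coe_union,
    ← Set.encard_coe_eq_coe_finsetCard]
  exact M.underlying.eRk_union_le_encard_add_eRk _ _

theorem rank_insert_of_isCircuit {X : α → SignType} (hX : M.IsCircuit X) (hXω : X ω ≠ 0)
    {B : Finset α} (hXB : ∀ e, X e ≠ 0 → e = ω ∨ e ∈ B) :
    M.rank (insert ω B) = M.rank B := by
  have hcl : ω ∈ M.underlying.closure (B : Set α) := by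
    refine Set.mem_of_mem_of_subset
      ((IsCircuit.isCircuit_support M hX).mem_closure_sdiff_singleton_of_mem hXω)
      (M.underlying.closure_subset_closure ?_)
    rintro e ⟨h1, h2⟩
    exact (hXB e h1).resolve_left h2
  rw [rank, rank, Finset.coe_insert, ← Matroid.eRk_closure_eq,
    Matroid.closure_insert_eq_of_mem_closure hcl, Matroid.eRk_closure_eq]

theorem rank_insert_of_isCocircuit {Y : α → SignType} (hY : M.IsCocircuit Y) (hYω : Y ω ≠ 0)
    {B : Finset α} (hYB : ∀ e ∈ B, Y e = 0) :
    M.rank (insert ω B) = M.rank B + 1 := by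
  have hωB : ω ∉ (B : Set α) := fun h => hYω (hYB ω h)
  have hcl : ω ∉ M.underlying.closure (B : Set α) := by
    intro hcl
    obtain ⟨C, hCB, hC, hωC⟩ := Matroid.exists_isCircuit_of_mem_closure hcl hωB
    refine hC.inter_isCocircuit_ne_singleton hY.1 (e := ω) ?_
    refine Set.Subset.antisymm ?_ (by simpa using ⟨hωC, hYω⟩)
    rintro e ⟨h1, h2⟩
    exact (hCB h1).resolve_right fun h => h2 (hYB e h)
  have h := Matroid.eRk_insert_eq_add_one ⟨hY.1.subset_ground hYω, hcl⟩
  rw [← Nat.cast_inj (R := ℕ∞), Nat.cast_add, coe_rank, coe_rank, Finset.coe_insert, h,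
    Nat.cast_one]

/-- The rank generating sum of the minor on `S` in which `V` is contracted. -/
noncomputable def rankSum (S V : Finset α) (p q : R) : R :=
  ∑ B ∈ S.powerset, p ^ (M.rank (S ∪ V) - M.rank (B ∪ V)) *
    q ^ (B.card + M.rank V - M.rank (B ∪ V))

theorem rankSum_loop (hωT : ω ∉ T) (h : ∀ B : Finset α, V ⊆ B → M.rank (insert ω B) = M.rank B)
    (p q : R) : M.rankSum (insert ω T) V p q = (1 + q) * M.rankSum T V p q := by
  rw [rankSum, Finset.sum_powerset_insert hωT, ← Finset.sum_add_distrib, rankSum, Finset.mul_sum]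
  refine Finset.sum_congr rfl fun B hB => ?_
  have hωB : ω ∉ B := fun h => hωT (Finset.mem_powerset.1 hB h)
  have h1 := M.rank_union_le B V
  rw [Finset.insert_union, Finset.insert_union, h _ Finset.subset_union_right,
    h _ Finset.subset_union_right, Finset.card_insert_of_notMem hωB,
    show B.card + 1 + M.rank V - M.rank (B ∪ V) = B.card + M.rank V - M.rank (B ∪ V) + 1 by omega]
  ring

theorem rankSum_coloop (hωT : ω ∉ T)
    (h : ∀ B : Finset α, B ⊆ T ∪ V → M.rank (insert ω B) = M.rank B + 1) (p q : R) :
    M.rankSum (insert ω T) V p q = (1 + p) * M.rankSum T (insert ω V) p q := by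
  rw [rankSum, Finset.sum_powerset_insert hωT, ← Finset.sum_add_distrib, rankSum, Finset.mul_sum]
  refine Finset.sum_congr rfl fun B hB => ?_
  have hBT := Finset.mem_powerset.1 hB
  have hωB : ω ∉ B := fun h => hωT (hBT h)
  have hBV : B ∪ V ⊆ T ∪ V := Finset.union_subset_union_left hBT
  have h1 := M.rank_mono hBV
  have h2 := M.rank_union_le B V
  simp only [Finset.insert_union, Finset.union_insert]
  rw [h _ hBV, h _ subset_rfl, h V Finset.subset_union_right, Finset.card_insert_of_notMem hωB,
    show M.rank (T ∪ V) + 1 - M.rank (B ∪ V) =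
      M.rank (T ∪ V) + 1 - (M.rank (B ∪ V) + 1) + 1 by omega,
    show B.card + 1 + M.rank V - (M.rank (B ∪ V) + 1) = B.card + M.rank V - M.rank (B ∪ V) by omega,
    show B.card + (M.rank V + 1) - (M.rank (B ∪ V) + 1) =
      B.card + M.rank V - M.rank (B ∪ V) by omega]
  ring

theorem rankSum_delete_contract (hωT : ω ∉ T) (h1 : M.rank (insert ω (T ∪ V)) = M.rank (T ∪ V))
    (h2 : M.rank (insert ω V) = M.rank V + 1) (p q : R) :
    M.rankSum (insert ω T) V p q = M.rankSum T V p q + M.rankSum T (insert ω V) p q := by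
  rw [rankSum, Finset.sum_powerset_insert hωT, rankSum, rankSum]
  congr 1
  · rw [Finset.insert_union, h1]
  · refine Finset.sum_congr rfl fun B hB => ?_
    have hωB : ω ∉ B := fun h => hωT (Finset.mem_powerset.1 hB h)
    simp only [Finset.insert_union, Finset.union_insert]
    rw [h2, Finset.card_insert_of_notMem hωB,
      show B.card + 1 + M.rank V = B.card + (M.rank V + 1) by omega]

end Rank

/-! ### Comparison of the two recursions. -/

section Main

variable {α : Type*} [LinearOrder α] (M : OrientedMatroid α) {R : Type*} [CommRing R]

theorem rankSum_eq_activitySum (x u y v : R) (S : Finset α) :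
    ∀ (Z : Set α) (V : Finset α), IsMinorPartition S Z V → S ⊆ M.E →
      M.rankSum S V (x + u - 1) (y + v - 1) =
        activitySum M.IsCircuit M.IsCocircuit S Z V x u y v := by
  induction S using Finset.induction_on_max with
  | empty =>
    intro Z V _ _
    simp [rankSum, activitySum, activityTerm, activeSet]
  | insert ω T hω ih =>
    intro Z V hp hS
    have hωT : ω ∉ T := fun h => lt_irrefl _ (hω ω h)
    have hωE : ω ∈ M.E := hS (Finset.mem_insert_self _ _)
    have hTE : T ⊆ M.E := fun e he => hS (Finset.mem_insert_of_mem he)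
    have hωV : ω ∉ (V : Set α) := hp.right ω (Finset.mem_insert_self _ _)
    have hCD := M.isDualPair
    have ihc := ih Z (insert ω V) (by rw [Finset.coe_insert]; exact hp.contract hωT) hTE
    have ihd := ih (insert ω Z) V (hp.delete hωT) hTE
    rw [Finset.coe_insert] at ihc
    by_cases hl : IsMinorLoop M.IsCircuit T Z ω
    · rw [activitySum_loop hCD hp hTE hω hl, ← ihd, rankSum_loop M hωT, add_sub_cancel]
      intro B hVB
      obtain ⟨X, hX, h1, h2, h3⟩ := hl
      refine M.rank_insert_of_isCircuit hX h1 fun e he => ?_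
      rcases hp.cover e with h | h | h
      · exact Or.inl ((Finset.mem_insert.1 h).resolve_right fun h' => he (h2 e h'))
      · exact absurd (h3 e h) he
      · exact Or.inr (hVB h)
    by_cases hc : IsMinorLoop M.IsCocircuit T V ω
    · rw [activitySum_coloop hCD hp hTE hω hc, ← ihc, rankSum_coloop M hωT, add_sub_cancel]
      intro B hB
      obtain ⟨Y, hY, h1, h2, h3⟩ := hc
      refine M.rank_insert_of_isCocircuit hY h1 fun e he => ?_
      rcases Finset.mem_union.1 (hB he) with h | h
      exacts [h2 e h, h3 e h]
    · rw [activitySum_delete_contract hCD hp hTE hω hl hc, ← ihd, ← ihc]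
      refine rankSum_delete_contract M hωT ?_ ?_ _ _
      -- A cocircuit here would make `ω` a coloop of the minor, so a circuit puts `ω` into the
      -- closure of `T ∪ V`.
      · rcases M.painting_singleton (↑(T ∪ V)) ω hωE (by
            rw [Finset.mem_coe, Finset.mem_union]; rintro (h | h); exacts [hωT h, hωV h])
            (s := 1) (by decide) with ⟨X, hX, h1, h2⟩ | ⟨Y, hY, h1, h2⟩
        · refine M.rank_insert_of_isCircuit hX (by rw [h1]; decide) fun e he => ?_
          by_contra! h
          exact he (h2 e h.1 h.2)
        · exact absurd ⟨Y, hY, by rw [h1]; decide, fun e he => h2 e (by simp [he]),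
            fun e he => h2 e (Finset.mem_coe.2 (Finset.mem_union_right _ he))⟩ hc
      -- Dually, a circuit here would make `ω` a loop of the minor, so a cocircuit through `ω`
      -- vanishes on `V`.
      · rcases M.painting_singleton (V : Set α) ω hωE hωV (s := 1) (by decide) with
          ⟨X, hX, h1, h2⟩ | ⟨Y, hY, h1, h2⟩
        · refine absurd ⟨X, hX, by rw [h1]; decide, fun e he => h2 e (hω e he).ne
            (hp.right e (Finset.mem_insert_of_mem he)), fun e he => h2 e ?_ (hp.disj e he)⟩ hl
          rintro rfl
          exact hp.left e (Finset.mem_insert_self _ _) he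
        · exact M.rank_insert_of_isCocircuit hY (by rw [h1]; decide) h2

/-! ### Reorientations as sign vectors. -/

theorem flip_apply (A : Finset α) (X : α → SignType) (e : α) :
    SignedSet.flip A X e = X e * reorientSign A e := by
  unfold SignedSet.flip reorientSign
  split_ifs <;> simp

theorem flip_flip (A : Finset α) (X : α → SignType) :
    SignedSet.flip A (SignedSet.flip A X) = X := by
  funext e
  simp only [SignedSet.flip]
  split_ifs <;> simp

theorem support_flip (A : Finset α) (X : α → SignType) :
    Function.support (SignedSet.flip A X) = Function.support X := by
  ext e
  simp only [Function.mem_support, SignedSet.flip]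
  generalize X e = s
  split_ifs <;> revert s <;> decide

theorem underlying_reorient (A : Finset α) : (M.reorient A).underlying = M.underlying := by
  refine Matroid.ext_indep rfl fun I _ => and_congr_right fun _ => ?_
  refine ⟨fun h X hX hXI => h (SignedSet.flip A X) ?_ ?_, fun h X hX hXI => h _ hX ?_⟩
  · change M.IsCircuit (SignedSet.flip A (SignedSet.flip A X))
    rwa [flip_flip]
  · rwa [support_flip]
  · rwa [support_flip]

theorem orthogonal_flip (A : Finset α) (X Y : α → SignType) :
    SignedSet.Orthogonal (SignedSet.flip A X) (SignedSet.flip A Y) ↔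
      SignedSet.Orthogonal X Y := by
  have h : ∀ e, SignedSet.flip A X e * SignedSet.flip A Y e = X e * Y e := by
    intro e
    rw [flip_apply, flip_apply]
    have := reorientSign_ne_zero A e
    revert this
    generalize X e = r; generalize Y e = s; generalize reorientSign A e = t
    revert r s t; decide
  simp only [SignedSet.Orthogonal, h]

theorem isCocircuit_reorient_iff (A : Finset α) (Y : α → SignType) :
    (M.reorient A).IsCocircuit Y ↔ M.IsCocircuit (SignedSet.flip A Y) := by
  unfold IsCocircuit
  rw [underlying_reorient, support_flip]
  refine and_congr_right fun _ => ⟨fun h X hX => ?_, fun h X hX => ?_⟩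
  · rw [← orthogonal_flip A, flip_flip]
    exact h _ (show M.IsCircuit (SignedSet.flip A (SignedSet.flip A X)) by rwa [flip_flip])
  · rw [← orthogonal_flip A]
    exact h _ hX

/-- Flipping turns positivity into agreement with `reorientSign A`; vanishing on `Z` is automatic
outside the ground set. -/
theorem exists_isLeast_iff_isActive {K : (α → SignType) → Prop} {E : Finset α} (A : Finset α)
    (hK : ∀ X, K X → Function.support X ⊆ (E : Set α)) {Z : Set α} (hZ : ∀ e ∈ Z, e ∉ E) {a : α} :
    (∃ X, K (SignedSet.flip A X) ∧ (∀ e, 0 ≤ X e) ∧ IsLeast (Function.support X) a) ↔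
      IsActive K E Z (reorientSign A) a := by
  have key : (∃ X, K (SignedSet.flip A X) ∧ (∀ e, 0 ≤ X e) ∧ IsLeast (Function.support X) a) ↔
      ∃ X, K X ∧ (∀ e, 0 ≤ SignedSet.flip A X e) ∧ IsLeast (Function.support X) a :=
    ⟨fun ⟨X, h1, h2, h3⟩ => ⟨_, h1, by rwa [flip_flip], by rwa [support_flip]⟩,
      fun ⟨X, h1, h2, h3⟩ => ⟨SignedSet.flip A X, by rwa [flip_flip], h2, by rwa [support_flip]⟩⟩
  rw [key]
  refine exists_congr fun X => and_congr_right fun hX => ?_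
  have hE : ∀ e, e ∉ E → X e = 0 := fun e he => by
    by_contra h
    exact he (hK X hX h)
  simp only [flip_apply]
  have s1 : ∀ s t : SignType, s ≠ 0 → t ≠ 0 → 0 ≤ s * t → s * t = 1 := by decide
  constructor
  · rintro ⟨h1, h2, h3⟩
    refine ⟨s1 _ _ h2 (reorientSign_ne_zero A a) (h1 a), fun e _ => h1 e, fun e _ hea => ?_,
      fun e he => hE e (hZ e he)⟩
    by_contra h
    exact not_lt.2 (h3 h) hea
  · rintro ⟨h1, h2, h3, -⟩
    refine ⟨fun e => ?_, fun h => ?_, fun e he => ?_⟩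
    · by_cases heE : e ∈ E
      · exact h2 e heE
      · rw [hE e heE, zero_mul]
    · rw [h, zero_mul] at h1
      exact absurd h1 (by decide)
    · by_contra! hea
      exact he (h3 e (hK X hX he) hea)

theorem active_reorient (A : Finset α) :
    (M.reorient A).active = activeSet M.IsCircuit M.E (M.E : Set α)ᶜ A := by
  classical
  ext a
  simp only [active, mem_activeSet, Finset.mem_filter]
  exact and_congr_right fun _ => exists_isLeast_iff_isActive A M.support_subset fun _ => id

theorem dualActive_reorient (A : Finset α) :
    (M.reorient A).dualActive = activeSet M.IsCocircuit M.E ∅ A := by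
  classical
  ext a
  simp only [dualActive, mem_activeSet, Finset.mem_filter, isCocircuit_reorient_iff]
  exact and_congr_right fun _ => exists_isLeast_iff_isActive A
    (fun _ hY => hY.1.subset_ground) fun _ he => absurd he (Set.notMem_empty _)

/-- The Tutte polynomial as a generating function of the activities of reorientations. -/
theorem aeval_tuttePolynomial (x u y v : R) :
    MvPolynomial.aeval ![x + u, y + v] M.tuttePolynomial =
      ∑ A ∈ M.E.powerset, x ^ (M.thetaStar A).card * u ^ (M.thetaStarBar A).card *
        y ^ (M.theta A).card * v ^ (M.thetaBar A).card := by
  -- A minor partition covers the whole type, so the elements outside the ground set count as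
  -- deleted.
  have hp : IsMinorPartition M.E (M.E : Set α)ᶜ ((∅ : Finset α) : Set α) :=
    ⟨fun e => by by_cases h : e ∈ M.E <;> simp [h], fun e he h => h he,
      fun e _ h => by simp at h, fun e _ h => by simp at h⟩
  have h := M.rankSum_eq_activitySum x u y v M.E _ ∅ hp subset_rfl
  have hr : M.rank ∅ = 0 := by simp [rank]
  simp only [rankSum, activitySum, Finset.union_empty, hr, add_zero, Finset.coe_empty] at h
  rw [tuttePolynomial, map_sum]
  simpa [activityTerm, theta, thetaBar, thetaStar, thetaStarBar, active_reorient,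
    dualActive_reorient] using h

end Main

end OrientedMatroid

theorem theorem7p4 {α : Type*} [LinearOrder α] (M : OrientedMatroid α)
    {R : Type*} [CommRing R] (x u y v : R) :
    MvPolynomial.aeval ![x + u, y + v] M.tuttePolynomial =
      ∑ A ∈ M.E.powerset, x ^ (M.thetaStar A).card * u ^ (M.thetaStarBar A).card *
        y ^ (M.theta A).card * v ^ (M.thetaBar A).card :=
  M.aeval_tuttePolynomial x u y v
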